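/- Let $T>0$, $\nu>0$, $\mu>0$, $\alpha\ge 0$, $a<0<b$, $y_\Omega\in C[0,1]$, $Q=(0,1)\times(0,T)$, and $U_{ad}=\{u\in L^2(0,T): a\le u(t)\le b \text{ for a.a. } t\in[0,T]\}$. For $u\in U_{ad}$ let $y_u\in C(\bar Q)$, with $\partial_x y_u\in L^2(Q)$, be the weak solution of $$y_t-y_{xx}=0 \text{ in } Q,\quad y_x(0,t)=0,\quad y_x(1,t)+\alpha\,y(1,t)=u(t) \text{ in } (0,T),\quad y(x,0)=0 \text{ in } (0,1).$$ Let $u_\nu\in U_{ad}$ be optimal for $$\min_{u\in U_{ad}}\ \frac12\int_0^1|y_u(x,T)-y_\Omega(x)|^2\,dx+\frac{\nu}{2}\int_0^T|u(t)|^2\,dt+\mu\int_0^T|u(t)|\,dt,$$ and let $\varphi_\nu\in C(\bar Q)$, with $\partial_x\varphi_\nu\in L^2(Q)$, be the associated adjoint state, i.e. the weak solution of $$-\varphi_t-\varphi_{xx}=0 \text{ in } Q,\quad \varphi_x(0,t)=0,\quad \varphi_x(1,t)+\alpha\,\varphi(1,t)=0 \text{ in } (0,T),\quad \varphi(x,T)=y_{u_\nu}(x,T)-y_\Omega(x)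 \text{ in } (0,1).$$ Then for almost all $t\in[0,T]$ the following implications hold: $$\begin{aligned} \varphi_\nu(1,t)\in(-\infty,-\mu-\nu b)&\ \Rightarrow\ u_\nu(t)=b,\\ \varphi_\nu(1,t)\in(-\mu-\nu b,-\mu)&\ \Rightarrow\ u_\nu(t)=-\tfrac1\nu(\varphi_\nu(1,t)+\mu),\\ \varphi_\nu(1,t)\in(-\mu,\mu)&\ \Rightarrow\ u_\nu(t)=0,\\ \varphi_\nu(1,t)\in(\mu,\mu-\nu a)&\ \Rightarrow\ u_\nu(t)=-\tfrac1\nu(\varphi_\nu(1,t)-\mu),\\ \varphi_\nu(1,t)\in(\mu-\nu a,\infty)&\ \Rightarrow\ u_\nu(t)=a. \end{aligned}$$ -/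

import Mathlib

open MeasureTheory Set

namespace SparseHeatControl

/-- The open space-time cylinder `Q = (0,1) × (0,T)`; points are pairs `(x, t)`. -/
def cylinder (T : ℝ) : Set (ℝ × ℝ) := Ioo (0 : ℝ) 1 ×ˢ Ioo (0 : ℝ) T

/-- `g ∈ L²(Q)` is the weak (distributional) derivative of `y` with respect to `x` on `Q`, tested
with all `η ∈ C¹_c(Q)`. -/
def HasWeakDerivX (T : ℝ) (y g : ℝ → ℝ → ℝ) : Prop :=
  MemLp (fun p : ℝ × ℝ => g p.1 p.2) 2 (volume.restrict (cylinder T)) ∧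
  ∀ η : ℝ → ℝ → ℝ,
    ContDiff ℝ 1 (fun p : ℝ × ℝ => η p.1 p.2) →
    HasCompactSupport (fun p : ℝ × ℝ => η p.1 p.2) →
    tsupport (fun p : ℝ × ℝ => η p.1 p.2) ⊆ cylinder T →
    ∫ p in cylinder T, y p.1 p.2 * deriv (fun x => η x p.2) p.1
      = - ∫ p in cylinder T, g p.1 p.2 * η p.1 p.2

/-- `y` is the state belonging to the boundary control `u`: the weak solution, continuous on the
closed cylinder and with `y_x ∈ L²(Q)`, of
`y_t - y_xx = 0` in `Q`, `y_x(0,t) = 0`, `y_x(1,t) + α y(1,t) = u(t)`, `y(x,0) = 0`.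
Test functions are the `v ∈ C¹`, with no condition at `t = T`, so that the value `y(·,T)` occurs
in the identity; the term `∫ y(x,0) v(x,0) dx` vanishes by the initial condition. -/
structure IsState (T α : ℝ) (u : ℝ → ℝ) (y : ℝ → ℝ → ℝ) : Prop where
  continuousOn : ContinuousOn (fun p : ℝ × ℝ => y p.1 p.2) (Icc (0 : ℝ) 1 ×ˢ Icc (0 : ℝ) T)
  initial : ∀ x ∈ Icc (0 : ℝ) 1, y x 0 = 0
  weak : ∃ g : ℝ → ℝ → ℝ, HasWeakDerivX T y g ∧
    ∀ v : ℝ → ℝ → ℝ, ContDiff ℝ 1 (fun p : ℝ × ℝ => v p.1 p.2) →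
      (∫ x in (0 : ℝ)..1, y x T * v x T)
        - (∫ p in cylinder T, y p.1 p.2 * deriv (fun t => v p.1 t) p.2)
        + (∫ p in cylinder T, g p.1 p.2 * deriv (fun x => v x p.2) p.1)
        + α * (∫ t in (0 : ℝ)..T, y 1 t * v 1 t)
      = ∫ t in (0 : ℝ)..T, u t * v 1 t

/-- `φ` is the weak solution, continuous on the closed cylinder and with `φ_x ∈ L²(Q)`, of the
backward problem `-φ_t - φ_xx = 0` in `Q`, `φ_x(0,t) = 0`, `φ_x(1,t) + α φ(1,t) = 0`,
`φ(x,T) = d(x)`. -/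
structure IsAdjointState (T α : ℝ) (d : ℝ → ℝ) (φ : ℝ → ℝ → ℝ) : Prop where
  continuousOn : ContinuousOn (fun p : ℝ × ℝ => φ p.1 p.2) (Icc (0 : ℝ) 1 ×ˢ Icc (0 : ℝ) T)
  terminal : ∀ x ∈ Icc (0 : ℝ) 1, φ x T = d x
  weak : ∃ g : ℝ → ℝ → ℝ, HasWeakDerivX T φ g ∧
    ∀ v : ℝ → ℝ → ℝ, ContDiff ℝ 1 (fun p : ℝ × ℝ => v p.1 p.2) →
      (∫ x in (0 : ℝ)..1, φ x 0 * v x 0)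
        + (∫ p in cylinder T, φ p.1 p.2 * deriv (fun t => v p.1 t) p.2)
        + (∫ p in cylinder T, g p.1 p.2 * deriv (fun x => v x p.2) p.1)
        + α * (∫ t in (0 : ℝ)..T, φ 1 t * v 1 t)
      = ∫ x in (0 : ℝ)..1, d x * v x T

/-- The admissible set `U_ad = {u ∈ L²(0,T) : a ≤ u(t) ≤ b for a.a. t}`. -/
def IsAdmissible (T a b : ℝ) (u : ℝ → ℝ) : Prop :=
  MemLp u 2 (volume.restrict (Icc (0 : ℝ) T)) ∧
  ∀ᵐ t ∂(volume.restrict (Icc (0 : ℝ) T)), a ≤ u t ∧ u t ≤ b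

/-- The objective functional
`J(y,u) = ½ ∫ |y(x,T) - y_Ω(x)|² dx + (ν/2) ∫ |u|² dt + μ ∫ |u| dt`. -/
noncomputable def cost (T ν μ : ℝ) (yΩ : ℝ → ℝ) (y : ℝ → ℝ → ℝ) (u : ℝ → ℝ) : ℝ :=
  (1 / 2) * (∫ x in (0 : ℝ)..1, |y x T - yΩ x| ^ 2)
    + (ν / 2) * (∫ t in (0 : ℝ)..T, |u t| ^ 2)
    + μ * (∫ t in (0 : ℝ)..T, |u t|)

/-- `u` is an optimal control with associated optimal state `y`: `(y, u)` minimizes `cost` among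
all pairs consisting of an admissible control and its state. -/
structure IsOptimal (T α ν μ a b : ℝ) (yΩ : ℝ → ℝ) (u : ℝ → ℝ) (y : ℝ → ℝ → ℝ) : Prop where
  admissible : IsAdmissible T a b u
  state : IsState T α u y
  minimal : ∀ (w : ℝ → ℝ) (z : ℝ → ℝ → ℝ), IsAdmissible T a b w → IsState T α w z →
    cost T ν μ yΩ y u ≤ cost T ν μ yΩ z w

end SparseHeatControl

/-! The cost is convex, so comparing `u` with points of the segment from `u` to an admissible `w`
gives `∫ (φ(1,t) + ν u)(w - u) + μ (|w| - |u|) dt ≥ 0` (`IsOptimal.variational`). For fixed `t` the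
minimiser over `[a,b]` of `r ↦ φ(1,t) r + (ν/2) r² + μ |r|` is a soft threshold followed by a
projection (`shrink`). By its own variational inequality (`shrink_variational`), the choice `w =
shrink (φ(1,·))` makes the integrand at most `-ν (w - u)²`. Hence `u = w` almost everywhere, and the
five cases are values of `shrink`.

The analytic content is the derivative of the tracking term: with `d = y(·,T) - yΩ`, a bounded
direction `h` must have a state `z` with `∫ d z(·,T) dx = ∫ φ(1,t) h(t) dt`
(`IsAdjointState.exists_state_duality`). The weak solutions `z` and `φ` are not `C¹`, so neither may
be used as a test function in the equation of the other; the identity is computed in the Neumann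
basis `cos(kπx)` instead. Uniqueness of weak solutions plays no role: one constructed `z` suffices,
because the optimal pair is compared with every state of every admissible control.

State: for a Neumann flux `q` the coefficients solve `a' = -(kπ)² a + q`, and the resulting cosine
series is a weak solution (`isState_neumannState`). The Robin condition is the feedback `q = h - α
z(1,·)`, a fixed point problem that is contractive after weighting by `exp(-γt)`
(`exists_neumann_flux`).

Adjoint: testing with `cos(kπx) θ(t)` shows that the coefficients of `φ` solve a backward ordinary
differential equation (`IsAdjointState.cosCoeff_eq`). Pairing the two equations for each `k` and
summing the cosine series at `x = 1` (`hasSum_cosCoeff`) yields the duality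
(`IsAdjointState.duality_of_continuous`). -/

namespace SparseHeatControl

/-! ### Cosine series and their value at the end point `x = 1`. -/

/-- The `k`-th cosine coefficient of a function on `[0,1]`. -/
noncomputable def cosCoeff (f : ℝ → ℝ) (k : ℕ) : ℝ :=
  ∫ x in (0 : ℝ)..1, Real.cos (k * Real.pi * x) * f x

/-- The normalisation `‖cos(kπ·)‖⁻²` in `L²(0,1)`. -/
noncomputable def cosWeight (k : ℕ) : ℝ := if k = 0 then 1 else 2

/-- The normalised value of `cos(kπ·)` at the right end point. -/
noncomputable def endWeight (k : ℕ) : ℝ := cosWeight k * Real.cos (k * Real.pi)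

lemma cosWeight_nonneg (k : ℕ) : 0 ≤ cosWeight k := by
  unfold cosWeight; split_ifs <;> norm_num

lemma cosWeight_le (k : ℕ) : cosWeight k ≤ 2 := by
  unfold cosWeight; split_ifs <;> norm_num

lemma abs_endWeight_le (k : ℕ) : |endWeight k| ≤ 2 := by
  unfold endWeight
  rw [abs_mul, abs_of_nonneg (cosWeight_nonneg k)]
  calc cosWeight k * |Real.cos (k * Real.pi)| ≤ 2 * 1 :=
        mul_le_mul (cosWeight_le k) (Real.abs_cos_le_one _) (abs_nonneg _) (by norm_num)
    _ = 2 := by norm_num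

/-- The lower bound transfers summability from the weighted coefficients to the coefficients
themselves. -/
lemma one_le_abs_endWeight (k : ℕ) : 1 ≤ |endWeight k| := by
  unfold endWeight
  have h : |Real.cos (k * Real.pi)| = 1 := by rw [Real.cos_nat_mul_pi, abs_pow]; norm_num
  rw [abs_mul, abs_of_nonneg (cosWeight_nonneg k), h, mul_one]
  unfold cosWeight; split_ifs <;> norm_num

lemma endWeight_mul_cos (k : ℕ) : endWeight k * Real.cos (k * Real.pi) = cosWeight k := by
  have h : Real.cos (k * Real.pi) * Real.cos (k * Real.pi) = 1 := by
    rw [Real.cos_nat_mul_pi, ← mul_pow]; norm_num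
  rw [endWeight, mul_assoc, h, mul_one]

/-- A continuous function on `[0,1]` with summable cosine coefficients is the sum of its cosine
series at the end point `1`. -/
theorem hasSum_cosCoeff {f : ℝ → ℝ} (hf : ContinuousOn f (Icc 0 1))
    (hs : Summable (cosCoeff f)) :
    HasSum (fun k => endWeight k * cosCoeff f k) (f 1) := by
  have : Fact (0 < (2 : ℝ)) := ⟨by norm_num⟩
  -- The even reflection is continuous on the circle of length 2, and its Fourier coefficients are
  -- the cosine coefficients of `f`.
  set e : ℝ → ℂ := fun x => ((f |x| : ℝ) : ℂ) with he
  have hfa : ContinuousOn (fun x : ℝ => f |x|) (Icc (-1) 1) :=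
    hf.comp continuous_abs.continuousOn (fun x hx => ⟨abs_nonneg x, abs_le.2 ⟨hx.1, hx.2⟩⟩)
  have hec : ContinuousOn e (Icc (-1) 1) :=
    Complex.continuous_ofReal.comp_continuousOn hfa
  have hcont : Continuous (AddCircle.liftIco (2 : ℝ) (-1) e) := by
    refine AddCircle.liftIco_continuous ?_ ?_
    · simp only [he]; norm_num
    · norm_num; exact hec
  let F : C(AddCircle (2 : ℝ), ℂ) := ⟨_, hcont⟩
  have hcoef : ∀ n : ℤ, fourierCoeff F n = ((cosCoeff f n.natAbs : ℝ) : ℂ) := by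
    intro n
    have hcosn : ∀ x : ℝ, Real.cos (n.natAbs * Real.pi * x) = Real.cos (n * Real.pi * x) := by
      intro x
      rw [Nat.cast_natAbs, Int.cast_abs, mul_assoc, mul_assoc]
      rcases abs_choice (n : ℝ) with h | h <;> rw [h]
      rw [neg_mul, Real.cos_neg]
    have hchar : ∀ x : ℝ, (fourier (-n) (x : AddCircle (2 : ℝ)) : ℂ)
        = Complex.exp (-(n * Real.pi * x : ℝ) * Complex.I) := by
      intro x
      rw [fourier_coe_apply]; congr 1; push_cast; ring
    have hint : ∀ a b : ℝ, a ∈ Icc (-1 : ℝ) 1 → b ∈ Icc (-1 : ℝ) 1 → IntervalIntegrable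
        (fun x : ℝ => Complex.exp (-(n * Real.pi * x : ℝ) * Complex.I) * e x) volume a b := by
      intro a b hA hB
      apply ContinuousOn.intervalIntegrable
      refine ContinuousOn.mul (Continuous.continuousOn (by fun_prop)) (hec.mono ?_)
      exact uIcc_subset_Icc hA hB
    have h1 : fourierCoeff F n = (1 / 2 : ℝ) •
        ∫ x in (-1 : ℝ)..1, Complex.exp (-(n * Real.pi * x : ℝ) * Complex.I) * e x := by
      change fourierCoeff (AddCircle.liftIco (2 : ℝ) (-1) e) n = _
      rw [fourierCoeff_eq_intervalIntegral _ _ (-1)]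
      have : (-1 : ℝ) + 2 = 1 := by norm_num
      congr 1
      rw [this]
      refine intervalIntegral.integral_congr_Ioo_of_le (by norm_num) fun x hx => ?_
      simp only [smul_eq_mul]
      rw [hchar, AddCircle.liftIco_coe_apply (by
        have := Ioo_subset_Ico_self hx
        norm_num at this ⊢; exact this)]
    have h2 : ∫ x in (-1 : ℝ)..0, Complex.exp (-(n * Real.pi * x : ℝ) * Complex.I) * e x
        = ∫ x in (0 : ℝ)..1, Complex.exp ((n * Real.pi * x : ℝ) * Complex.I) * e x := by
      have := intervalIntegral.integral_comp_neg (a := 0) (b := 1)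
        (fun x : ℝ => Complex.exp (-(n * Real.pi * x : ℝ) * Complex.I) * e x)
      rw [neg_zero] at this
      rw [← this]
      congr 1; ext x
      simp only [he, abs_neg]
      congr 2; push_cast; ring
    have i0 := hint 0 1 (by norm_num) (by norm_num)
    have i1 : IntervalIntegrable
        (fun x : ℝ => Complex.exp ((n * Real.pi * x : ℝ) * Complex.I) * e x) volume 0 1 := by
      apply ContinuousOn.intervalIntegrable
      refine ContinuousOn.mul (Continuous.continuousOn (by fun_prop)) (hec.mono ?_)
      exact uIcc_subset_Icc (by norm_num) (by norm_num)
    rw [h1, ← intervalIntegral.integral_add_adjacent_intervals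
      (hint (-1) 0 (by norm_num) (by norm_num)) i0, h2,
      ← intervalIntegral.integral_add i1 i0, cosCoeff, ← intervalIntegral.integral_ofReal,
      ← intervalIntegral.integral_smul]
    refine intervalIntegral.integral_congr fun x hx => ?_
    rw [uIcc_of_le (by norm_num)] at hx
    simp only [he, abs_of_nonneg hx.1, hcosn]
    rw [← add_mul]
    have : Complex.exp ((n * Real.pi * x : ℝ) * Complex.I)
        + Complex.exp (-(n * Real.pi * x : ℝ) * Complex.I)
        = 2 * ((Real.cos (n * Real.pi * x) : ℝ) : ℂ) := by
      rw [Complex.ofReal_cos, Complex.two_cos]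
    rw [this, Complex.real_smul]; push_cast; ring
  have hsum : Summable (fourierCoeff F) := by
    have h : Summable fun n : ℤ => cosCoeff f n.natAbs :=
      Summable.of_nat_of_neg (by simpa using hs) (by simpa using hs)
    have h' := Complex.ofRealCLM.summable h
    refine h'.congr fun n => ?_
    rw [hcoef]; simp
  -- The points `-1` and `1` coincide on this circle; `-1` is the representative lying in `Ico (-1)
  -- 1`.
  have hpt := has_pointwise_sum_fourier_series_of_summable hsum ((-1 : ℝ) : AddCircle (2 : ℝ))
  have hval : F ((-1 : ℝ) : AddCircle (2 : ℝ)) = ((f 1 : ℝ) : ℂ) := by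
    change AddCircle.liftIco (2 : ℝ) (-1) e _ = _
    rw [AddCircle.liftIco_coe_apply (by norm_num)]
    simp [he]
  have hch : ∀ n : ℤ, (fourier n ((-1 : ℝ) : AddCircle (2 : ℝ)) : ℂ)
      = ((Real.cos (n * Real.pi) : ℝ) : ℂ) := by
    intro n
    rw [fourier_coe_apply]
    have h0 : Real.sin (n * Real.pi) = 0 := Real.sin_int_mul_pi n
    have : (2 * Real.pi * Complex.I * n * (-1 : ℝ) / (2 : ℝ) : ℂ)
        = ((-(n * Real.pi) : ℝ) : ℂ) * Complex.I := by push_cast; ring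
    rw [this, Complex.exp_mul_I, ← Complex.ofReal_cos, ← Complex.ofReal_sin, Real.cos_neg,
      Real.sin_neg, h0]
    simp
  have hreal : HasSum (fun n : ℤ => cosCoeff f n.natAbs * Real.cos (n * Real.pi)) (f 1) := by
    rw [hval] at hpt
    have := Complex.hasSum_re hpt
    simp only [Complex.ofReal_re] at this
    convert! this using 2 with n
    rw [hcoef, hch, smul_eq_mul, ← Complex.ofReal_mul, Complex.ofReal_re]
  have hnat := HasSum.nat_add_neg hreal
  -- Folding `n` with `-n` counts `n = 0` twice. Removing one copy explains `cosWeight 0 = 1`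
  -- against `2` elsewhere.
  have hdel : HasSum (fun k : ℕ => if k = 0 then -cosCoeff f 0 else 0) (-cosCoeff f 0) := by
    convert! hasSum_ite_eq (0 : ℕ) (-cosCoeff f 0) using 1
  have := hnat.add hdel
  convert! this using 1
  · ext k
    simp only [Int.natAbs_natCast, Int.natAbs_neg, endWeight, cosWeight]
    have : Real.cos (((-(k : ℤ) : ℤ) : ℝ) * Real.pi) = Real.cos (k * Real.pi) := by
      push_cast; rw [← Real.cos_neg]; congr 1; ring
    rw [this]
    by_cases hk : k = 0
    · subst hk; simp
    · simp only [hk, if_false]; push_cast; ring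
  · simp

/-! ### Duhamel integrals of the scalar equations, and sums over the eigenvalues. -/

/-- `duhamel m q` solves `a' = -m a + q`, `a(0) = 0`. -/
noncomputable def duhamel (m : ℝ) (q : ℝ → ℝ) (t : ℝ) : ℝ :=
  ∫ s in (0 : ℝ)..t, Real.exp (-m * (t - s)) * q s

lemma duhamel_eq (m : ℝ) (q : ℝ → ℝ) (t : ℝ) :
    duhamel m q t = Real.exp (-m * t) * ∫ s in (0 : ℝ)..t, Real.exp (m * s) * q s := by
  rw [duhamel, ← intervalIntegral.integral_const_mul]
  congr 1; ext s
  rw [← mul_assoc, ← Real.exp_add]; congr 2; ring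

lemma intervalIntegrable_of_bounded {q : ℝ → ℝ} (hq : Measurable q) {C : ℝ}
    (hC : ∀ t, |q t| ≤ C) (a b : ℝ) : IntervalIntegrable q volume a b :=
  intervalIntegrable_iff.2 <|
    Measure.integrableOn_of_bounded (M := C) (by simp [uIoc]) hq.aestronglyMeasurable
      (ae_of_all _ hC)

lemma continuous_duhamel {q : ℝ → ℝ} (hq : ∀ a b, IntervalIntegrable q volume a b) (m : ℝ) :
    Continuous (duhamel m q) := by
  have : duhamel m q = fun t => Real.exp (-m * t) * ∫ s in (0 : ℝ)..t, Real.exp (m * s) * q s :=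
    funext (duhamel_eq m q)
  rw [this]
  refine Continuous.mul (by fun_prop) ?_
  exact intervalIntegral.continuous_primitive
    (fun a b => (hq a b).continuousOn_mul (by fun_prop)) 0

lemma duhamel_zero (m : ℝ) (q : ℝ → ℝ) : duhamel m q 0 = 0 := by simp [duhamel]

/-- This `1 / m` becomes the `k⁻²` decay of the cosine coefficients. -/
lemma integral_exp_decay_le {m t : ℝ} (hm : 0 < m) :
    ∫ s in (0 : ℝ)..t, Real.exp (-m * (t - s)) ≤ 1 / m := by
  have : ∀ s ∈ uIcc 0 t, HasDerivAt (fun s => Real.exp (-m * (t - s)) / m)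
      (Real.exp (-m * (t - s))) s := by
    intro s _
    have h : HasDerivAt (fun s => -m * (t - s)) m s := by
      have := ((hasDerivAt_id s).const_sub t).const_mul (-m)
      convert! this using 1; ring
    have := h.exp.div_const m
    convert! this using 1
    field_simp
  have hc : Continuous fun s => Real.exp (-m * (t - s)) := by fun_prop
  rw [intervalIntegral.integral_eq_sub_of_hasDerivAt this (hc.intervalIntegrable (μ := volume) _ _)]
  rw [sub_self, mul_zero, Real.exp_zero]
  have : 0 ≤ Real.exp (-m * (t - 0)) / m := by positivity
  linarith

lemma abs_duhamel_le {q : ℝ → ℝ} {m C t : ℝ} (hm : 0 < m) (ht : 0 ≤ t)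
    (hC : ∀ s ∈ Icc 0 t, |q s| ≤ C) : |duhamel m q t| ≤ C / m := by
  have hC0 : 0 ≤ C := (abs_nonneg _).trans (hC 0 ⟨le_rfl, ht⟩)
  have hc : Continuous fun s => Real.exp (-m * (t - s)) * C := by fun_prop
  have hi : IntervalIntegrable (fun s => Real.exp (-m * (t - s)) * C) volume 0 t :=
    hc.intervalIntegrable _ _
  calc |duhamel m q t| ≤ ∫ s in (0 : ℝ)..t, Real.exp (-m * (t - s)) * C := by
        rw [duhamel, ← Real.norm_eq_abs]
        refine intervalIntegral.norm_integral_le_of_norm_le ht ?_ hi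
        refine ae_of_all _ fun s hs => ?_
        rw [Real.norm_eq_abs, abs_mul, abs_of_pos (Real.exp_pos _)]
        exact mul_le_mul_of_nonneg_left (hC s (Ioc_subset_Icc_self hs)) (Real.exp_pos _).le
    _ = (∫ s in (0 : ℝ)..t, Real.exp (-m * (t - s))) * C := by
        rw [intervalIntegral.integral_mul_const]
    _ ≤ 1 / m * C := mul_le_mul_of_nonneg_right (integral_exp_decay_le hm) hC0
    _ = C / m := by ring

/-- An exponential weight in time raises the decay rate by `γ`. The value `γ = 1` covers the zero
eigenvalue; a large `γ` makes the boundary feedback contractive. -/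
lemma duhamel_shift (m γ : ℝ) (q : ℝ → ℝ) (t : ℝ) :
    duhamel m q t = Real.exp (γ * t) * duhamel (m + γ) (fun s => Real.exp (-γ * s) * q s) t := by
  rw [duhamel, duhamel, ← intervalIntegral.integral_const_mul]
  congr 1; ext s
  rw [← mul_assoc, ← mul_assoc, ← Real.exp_add, ← Real.exp_add]; congr 2; ring

lemma abs_duhamel_le' {q : ℝ → ℝ} {m C T t : ℝ} (hm : 0 ≤ m) (ht : t ∈ Icc 0 T)
    (hC : ∀ s, |q s| ≤ C) : |duhamel m q t| ≤ Real.exp T * C / (m + 1) := by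
  have hC0 : 0 ≤ C := (abs_nonneg _).trans (hC 0)
  rw [duhamel_shift m 1, abs_mul, abs_of_pos (Real.exp_pos _), mul_div_assoc]
  refine mul_le_mul (Real.exp_le_exp.2 (by linarith [ht.2])) ?_ (abs_nonneg _) (Real.exp_pos _).le
  refine abs_duhamel_le (by linarith) ht.1 fun s hs => ?_
  rw [abs_mul, abs_of_pos (Real.exp_pos _)]
  calc Real.exp (-1 * s) * |q s| ≤ 1 * C :=
        mul_le_mul (Real.exp_le_one_iff.2 (by linarith [hs.1])) (hC s) (abs_nonneg _) zero_le_one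
    _ = C := one_mul C

/-- Integration by parts for the solution of `a' = -m a + q`. -/
lemma mul_duhamel_eq {q : ℝ → ℝ} (hq : ∀ a b, IntervalIntegrable q volume a b) (m T : ℝ)
    {F F' : ℝ → ℝ} (hF : ∀ t, HasDerivAt F (F' t) t) (hF' : Continuous F') :
    F T * duhamel m q T =
      (∫ t in (0 : ℝ)..T, (F' t - m * F t) * duhamel m q t) + ∫ t in (0 : ℝ)..T, F t * q t := by
  have hFc : Continuous F := continuous_iff_continuousAt.2 fun t => (hF t).continuousAt
  set Q : ℝ → ℝ := fun s => Real.exp (m * s) * q s with hQ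
  have hQi : ∀ a b, IntervalIntegrable Q volume a b := fun a b =>
    (hq a b).continuousOn_mul (by fun_prop)
  set G : ℝ → ℝ := fun t => Real.exp (-m * t) * F t with hG
  have hGd : ∀ t, HasDerivAt G (Real.exp (-m * t) * (F' t - m * F t)) t := by
    intro t
    have h : HasDerivAt (fun t => -m * t) (-m) t := by
      simpa using (hasDerivAt_id t).const_mul (-m)
    convert! h.exp.mul (hF t) using 1; ring
  have hGdc : Continuous fun t => Real.exp (-m * t) * (F' t - m * F t) := by fun_prop
  -- As `q` is only integrable, its primitive is merely absolutely continuous, so the integration by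
  -- parts takes place in that class.
  have hGac : AbsolutelyContinuousOnInterval G 0 T := by
    have : ContDiff ℝ 1 G := contDiff_one_iff_deriv.2
      ⟨fun t => (hGd t).differentiableAt, by
        rw [show deriv G = _ from funext fun t => (hGd t).deriv]; exact hGdc⟩
    exact this.contDiffOn.absolutelyContinuousOnInterval
  have hPac := (hQi 0 T).absolutelyContinuousOnInterval_intervalIntegral
    (c := 0) (by simp)
  have key := hGac.integral_mul_deriv_eq_deriv_mul hPac
  have hd : ∫ x in (0 : ℝ)..T, G x * deriv (fun x => ∫ v in (0 : ℝ)..x, Q v) x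
      = ∫ t in (0 : ℝ)..T, F t * q t := by
    apply intervalIntegral.integral_congr_ae
    filter_upwards [(hQi 0 T).ae_hasDerivAt_integral] with x hx hx'
    rw [(hx (uIoc_subset_uIcc hx') 0 (by simp)).deriv]
    simp only [hG, hQ]
    rw [show Real.exp (-m * x) * F x * (Real.exp (m * x) * q x)
      = (Real.exp (-m * x) * Real.exp (m * x)) * (F x * q x) by ring, ← Real.exp_add]
    simp
  have hd' : ∫ x in (0 : ℝ)..T, deriv G x * (∫ v in (0 : ℝ)..x, Q v)
      = ∫ t in (0 : ℝ)..T, (F' t - m * F t) * duhamel m q t := by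
    congr 1; ext t
    rw [(hGd t).deriv, duhamel_eq]; ring
  rw [hd, hd'] at key
  rw [duhamel_eq m q T, key]
  simp only [hG, hQ, intervalIntegral.integral_same, mul_zero, sub_zero]
  ring

/-- The Neumann eigenvalues `(kπ)²`, shifted by one, have summable reciprocals. -/
lemma summable_inv_eigenvalue {γ : ℝ} (hγ : 0 < γ) :
    Summable fun k : ℕ => 1 / ((k * Real.pi) ^ 2 + γ) := by
  have h : Summable fun k : ℕ => 1 / ((k : ℝ) ^ 2) :=
    Real.summable_one_div_nat_pow.2 (by norm_num)
  rw [← summable_nat_add_iff 1] at h ⊢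
  refine Summable.of_nonneg_of_le (fun k => by positivity) (fun k => ?_) h
  refine one_div_le_one_div_of_le (by positivity) ?_
  have : (1 : ℝ) ≤ Real.pi ^ 2 := by nlinarith [Real.pi_gt_three]
  rw [mul_pow]
  have h2 : 0 ≤ (((k + 1 : ℕ) : ℝ)) ^ 2 := by positivity
  nlinarith

lemma summable_const_div_eigenvalue (C : ℝ) :
    Summable fun k : ℕ => C / ((k * Real.pi) ^ 2 + 1) := by
  simpa [div_eq_mul_inv] using (summable_inv_eigenvalue zero_lt_one).mul_left C

/-! ### Partial derivatives of `C¹` test functions and of their cosine coefficients. -/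

section PartialDerivatives

variable {v : ℝ → ℝ → ℝ}

lemma hasDerivAt_fst (hv : ContDiff ℝ 1 (fun p : ℝ × ℝ => v p.1 p.2)) (x t : ℝ) :
    HasDerivAt (fun x => v x t) (fderiv ℝ (fun p : ℝ × ℝ => v p.1 p.2) (x, t) (1, 0)) x := by
  have h := ((hv.differentiable one_ne_zero) (x, t)).hasFDerivAt
  have h2 : HasDerivAt (fun x : ℝ => (x, t)) ((1 : ℝ), (0 : ℝ)) x :=
    (hasDerivAt_id x).prodMk (hasDerivAt_const x t)
  exact h.comp_hasDerivAt x h2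

lemma hasDerivAt_snd (hv : ContDiff ℝ 1 (fun p : ℝ × ℝ => v p.1 p.2)) (x t : ℝ) :
    HasDerivAt (fun t => v x t) (fderiv ℝ (fun p : ℝ × ℝ => v p.1 p.2) (x, t) (0, 1)) t := by
  have h := ((hv.differentiable one_ne_zero) (x, t)).hasFDerivAt
  have h2 : HasDerivAt (fun t : ℝ => (x, t)) ((0 : ℝ), (1 : ℝ)) t :=
    (hasDerivAt_const t x).prodMk (hasDerivAt_id t)
  exact h.comp_hasDerivAt t h2

lemma continuous_deriv_fst (hv : ContDiff ℝ 1 (fun p : ℝ × ℝ => v p.1 p.2)) :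
    Continuous fun p : ℝ × ℝ => deriv (fun x => v x p.2) p.1 := by
  rw [show (fun p : ℝ × ℝ => deriv (fun x => v x p.2) p.1)
    = fun p => fderiv ℝ (fun p : ℝ × ℝ => v p.1 p.2) p (1, 0) from
      funext fun p => (hasDerivAt_fst hv p.1 p.2).deriv]
  exact (hv.continuous_fderiv one_ne_zero).clm_apply continuous_const

lemma continuous_deriv_snd (hv : ContDiff ℝ 1 (fun p : ℝ × ℝ => v p.1 p.2)) :
    Continuous fun p : ℝ × ℝ => deriv (fun t => v p.1 t) p.2 := by
  rw [show (fun p : ℝ × ℝ => deriv (fun t => v p.1 t) p.2)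
    = fun p => fderiv ℝ (fun p : ℝ × ℝ => v p.1 p.2) p (0, 1) from
      funext fun p => (hasDerivAt_snd hv p.1 p.2).deriv]
  exact (hv.continuous_fderiv one_ne_zero).clm_apply continuous_const

/-- Differentiation of the cosine coefficients with respect to the time variable. -/
lemma hasDerivAt_cosCoeff (hv : ContDiff ℝ 1 (fun p : ℝ × ℝ => v p.1 p.2)) (k : ℕ) (t : ℝ) :
    HasDerivAt (fun t => cosCoeff (fun x => v x t) k)
      (cosCoeff (fun x => deriv (fun t => v x t) t) k) t := by
  have hvc := hv.continuous
  have hdc := continuous_deriv_snd hv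
  obtain ⟨C, hC⟩ := (isCompact_Icc.prod isCompact_Icc :
    IsCompact (Icc (0 : ℝ) 1 ×ˢ Icc (t - 1) (t + 1))).exists_bound_of_continuousOn hdc.continuousOn
  have hc1 : ∀ t, Continuous fun x => Real.cos (k * Real.pi * x) * v x t := fun t =>
    (by fun_prop : Continuous fun x : ℝ => Real.cos (k * Real.pi * x)).mul
      (hvc.comp (by fun_prop : Continuous fun x : ℝ => (x, t)))
  have hc2 : Continuous fun x => Real.cos (k * Real.pi * x) * deriv (fun t => v x t) t :=
    (by fun_prop : Continuous fun x : ℝ => Real.cos (k * Real.pi * x)).mul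
      (hdc.comp (by fun_prop : Continuous fun x : ℝ => (x, t)))
  refine (intervalIntegral.hasDerivAt_integral_of_dominated_loc_of_deriv_le
    (F := fun t x => Real.cos (k * Real.pi * x) * v x t)
    (F' := fun t x => Real.cos (k * Real.pi * x) * deriv (fun t => v x t) t)
    (bound := fun _ => C) (Icc_mem_nhds (by linarith : t - 1 < t) (by linarith : t < t + 1))
    (Filter.Eventually.of_forall fun t => (hc1 t).aestronglyMeasurable)
    ((hc1 t).intervalIntegrable _ _) hc2.aestronglyMeasurable ?_
    intervalIntegrable_const ?_).2
  · refine ae_of_all _ fun x hx s hs => ?_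
    rw [uIoc_of_le zero_le_one] at hx
    rw [norm_mul]
    calc _ ≤ 1 * C := mul_le_mul (Real.abs_cos_le_one _) (hC (x, s) ⟨Ioc_subset_Icc_self hx, hs⟩)
            (norm_nonneg _) zero_le_one
      _ = C := one_mul C
  · refine ae_of_all _ fun x hx s hs => ?_
    have := hasDerivAt_snd hv x s
    rw [← this.deriv] at this
    exact this.const_mul _

lemma continuous_cosCoeff {f : ℝ → ℝ → ℝ} (hf : Continuous fun p : ℝ × ℝ => f p.1 p.2) (k : ℕ) :
    Continuous fun t => cosCoeff (fun x => f x t) k := by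
  unfold cosCoeff
  refine intervalIntegral.continuous_parametric_intervalIntegral_of_continuous' ?_ 0 1
  refine Continuous.mul (by fun_prop) ?_
  exact hf.comp continuous_swap

end PartialDerivatives

/-! ### Integration over the cylinder. -/

section Cylinder

lemma restrict_cylinder (T : ℝ) : (volume : Measure (ℝ × ℝ)).restrict (cylinder T)
    = (volume.restrict (Ioo (0 : ℝ) 1)).prod (volume.restrict (Ioo (0 : ℝ) T)) := by
  rw [Measure.prod_restrict, cylinder, Measure.volume_eq_prod]

lemma measurableSet_cylinder (T : ℝ) : MeasurableSet (cylinder T) :=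
  measurableSet_Ioo.prod measurableSet_Ioo

lemma cylinder_subset (T : ℝ) : cylinder T ⊆ Icc (0 : ℝ) 1 ×ˢ Icc (0 : ℝ) T :=
  prod_mono Ioo_subset_Icc_self Ioo_subset_Icc_self

instance isFiniteMeasure_cylinder (T : ℝ) :
    IsFiniteMeasure ((volume : Measure (ℝ × ℝ)).restrict (cylinder T)) := by
  rw [restrict_cylinder]; infer_instance

lemma integral_cylinder {T : ℝ} (hT : 0 ≤ T) {f : ℝ × ℝ → ℝ}
    (hf : Integrable f (volume.restrict (cylinder T))) :
    ∫ p in cylinder T, f p = ∫ t in (0 : ℝ)..T, ∫ x in (0 : ℝ)..1, f (x, t) := by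
  rw [restrict_cylinder] at hf ⊢
  rw [integral_prod_symm _ hf, intervalIntegral.integral_of_le hT, integral_Ioc_eq_integral_Ioo]
  simp_rw [intervalIntegral.integral_of_le (zero_le_one (α := ℝ)), integral_Ioc_eq_integral_Ioo]

lemma memLp_cylinder {T : ℝ} {f : ℝ × ℝ → ℝ}
    (hf : ContinuousOn f (Icc (0 : ℝ) 1 ×ˢ Icc (0 : ℝ) T)) (r : ENNReal) :
    MemLp f r (volume.restrict (cylinder T)) := by
  obtain ⟨C, hC⟩ := (isCompact_Icc.prod isCompact_Icc :
    IsCompact (Icc (0 : ℝ) 1 ×ˢ Icc (0 : ℝ) T)).exists_bound_of_continuousOn hf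
  refine MemLp.of_bound ((hf.mono (cylinder_subset T)).aestronglyMeasurable
    (measurableSet_cylinder T)) C ?_
  exact (ae_restrict_mem (measurableSet_cylinder T)).mono fun p hp => hC p (cylinder_subset T hp)

lemma integrable_cylinder {T : ℝ} {f : ℝ × ℝ → ℝ}
    (hf : ContinuousOn f (Icc (0 : ℝ) 1 ×ˢ Icc (0 : ℝ) T)) :
    Integrable f (volume.restrict (cylinder T)) :=
  memLp_one_iff_integrable.1 (memLp_cylinder hf 1)

lemma continuousOn_trace {T : ℝ} {z : ℝ → ℝ → ℝ}
    (hz : ContinuousOn (fun p : ℝ × ℝ => z p.1 p.2) (Icc (0 : ℝ) 1 ×ˢ Icc (0 : ℝ) T)) :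
    ContinuousOn (fun t => z 1 t) (Icc 0 T) :=
  hz.comp (by fun_prop : ContinuousOn (fun t : ℝ => ((1 : ℝ), t)) _) fun _ ht =>
    ⟨⟨zero_le_one, le_rfl⟩, ht⟩

lemma continuousOn_final {T : ℝ} (hT : 0 ≤ T) {z : ℝ → ℝ → ℝ}
    (hz : ContinuousOn (fun p : ℝ × ℝ => z p.1 p.2) (Icc (0 : ℝ) 1 ×ˢ Icc (0 : ℝ) T)) :
    ContinuousOn (fun x => z x T) (Icc 0 1) :=
  hz.comp (by fun_prop : ContinuousOn (fun x : ℝ => (x, T)) _) fun _ hx => ⟨hx, ⟨hT, le_rfl⟩⟩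

end Cylinder

/-! ### Orthogonal series in `L²` and trigonometric integrals. -/

/-- An orthogonal series in `L²` with summable squared norms converges weakly in `L²`. -/
theorem exists_memLp_hasSum_integral_mul {β : Type*} [MeasurableSpace β] {ρ : Measure β}
    {e : ℕ → β → ℝ} (he : ∀ k, MemLp (e k) 2 ρ)
    (horth : ∀ j k, j ≠ k → ∫ p, e j p * e k p ∂ρ = 0)
    (hs : Summable fun k => ∫ p, e k p * e k p ∂ρ) :
    ∃ g : β → ℝ, MemLp g 2 ρ ∧ ∀ ψ : β → ℝ, MemLp ψ 2 ρ →
      HasSum (fun k => ∫ p, e k p * ψ p ∂ρ) (∫ p, g p * ψ p ∂ρ) := by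
  have hinner : ∀ {f g : β → ℝ} (hf : MemLp f 2 ρ) (hg : MemLp g 2 ρ),
      inner ℝ (hg.toLp g) (hf.toLp f) = ∫ p, f p * g p ∂ρ := by
    intro f g hf hg
    rw [L2.inner_def]
    refine integral_congr_ae ?_
    filter_upwards [hf.coeFn_toLp, hg.coeFn_toLp] with p h1 h2
    rw [h1, h2]; simp
  set E : ℕ → Lp ℝ 2 ρ := fun k => (he k).toLp (e k) with hE
  -- For an orthogonal family, summability in norm-topology is equivalent to summability of the
  -- squared norms.
  have hfam : OrthogonalFamily ℝ (fun k => Submodule.span ℝ {E k})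
      (fun k => (Submodule.span ℝ {E k}).subtypeₗᵢ) := by
    refine OrthogonalFamily.of_pairwise fun j k hjk => ?_
    refine Submodule.isOrtho_span.2 ?_
    rintro _ rfl _ rfl
    rw [hinner]; exact horth _ _ hjk.symm
  have hsum : Summable E := by
    have := (hfam.summable_iff_norm_sq_summable
      (fun k => ⟨E k, Submodule.mem_span_singleton_self _⟩)).2 (by
        refine hs.congr fun k => ?_
        rw [← hinner (he k) (he k), real_inner_self_eq_norm_sq]; rfl)
    exact this
  refine ⟨_, Lp.memLp (∑' k, E k), fun ψ hψ => ?_⟩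
  have h := (innerSL ℝ (hψ.toLp ψ)).hasSum hsum.hasSum
  simp only [innerSL_apply_apply] at h
  convert! h using 1
  · ext k; rw [hinner]
  · rw [← hinner (Lp.memLp _) hψ, Lp.toLp_coeFn]

lemma integral_cos_int_mul_pi {n : ℤ} (hn : n ≠ 0) :
    ∫ x in (0 : ℝ)..1, Real.cos (n * Real.pi * x) = 0 := by
  have hc : (n : ℝ) * Real.pi ≠ 0 := mul_ne_zero (Int.cast_ne_zero.2 hn) Real.pi_ne_zero
  rw [intervalIntegral.integral_comp_mul_left (fun x => Real.cos x) hc, integral_cos]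
  simp [Real.sin_int_mul_pi]

lemma integral_sin_mul_sin {j k : ℕ} (h : j ≠ k) :
    ∫ x in (0 : ℝ)..1, Real.sin (j * Real.pi * x) * Real.sin (k * Real.pi * x) = 0 := by
  have hp : ∀ x : ℝ, Real.sin (j * Real.pi * x) * Real.sin (k * Real.pi * x)
      = 1 / 2 * Real.cos (((j : ℤ) - k : ℤ) * Real.pi * x)
        - 1 / 2 * Real.cos (((j : ℤ) + k : ℤ) * Real.pi * x) := by
    intro x
    push_cast
    rw [sub_mul, sub_mul, add_mul, add_mul, Real.cos_sub, Real.cos_add]; ring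
  simp_rw [hp]
  rw [intervalIntegral.integral_sub (Continuous.intervalIntegrable (by fun_prop) _ _)
    (Continuous.intervalIntegrable (by fun_prop) _ _), intervalIntegral.integral_const_mul,
    intervalIntegral.integral_const_mul, integral_cos_int_mul_pi (by omega),
    integral_cos_int_mul_pi (by omega)]
  simp

/-- Integration by parts against `sin(kπ·)`, which vanishes at both end points. -/
lemma integral_sin_mul_deriv {f f' : ℝ → ℝ} (hf : ∀ x, HasDerivAt f (f' x) x)
    (hf' : Continuous f') (k : ℕ) :
    ∫ x in (0 : ℝ)..1, k * Real.pi * Real.sin (k * Real.pi * x) * f' x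
      = -((k * Real.pi) ^ 2 * cosCoeff f k) := by
  have hs : ∀ x : ℝ, HasDerivAt (fun x => k * Real.pi * Real.sin (k * Real.pi * x))
      ((k * Real.pi) ^ 2 * Real.cos (k * Real.pi * x)) x := by
    intro x
    have h1 : HasDerivAt (fun x : ℝ => k * Real.pi * x) (k * Real.pi) x := by
      simpa using (hasDerivAt_id x).const_mul (k * Real.pi)
    convert! h1.sin.const_mul (k * Real.pi) using 1; ring
  rw [intervalIntegral.integral_mul_deriv_eq_deriv_mul (fun x _ => hs x) (fun x _ => hf x)
    (Continuous.intervalIntegrable (by fun_prop) _ _) (hf'.intervalIntegrable _ _), cosCoeff,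
    ← intervalIntegral.integral_const_mul]
  simp [Real.sin_nat_mul_pi, mul_assoc]

/-- Integration by parts against `cos(kπ·)` for functions vanishing at both end points. -/
lemma cosCoeff_deriv {f f' : ℝ → ℝ} (hf : ∀ x, HasDerivAt f (f' x) x)
    (hf' : Continuous f') (h0 : f 0 = 0) (h1 : f 1 = 0) (k : ℕ) :
    cosCoeff f' k = ∫ x in (0 : ℝ)..1, k * Real.pi * Real.sin (k * Real.pi * x) * f x := by
  have hs : ∀ x : ℝ, HasDerivAt (fun x => Real.cos (k * Real.pi * x))
      (-(k * Real.pi * Real.sin (k * Real.pi * x))) x := by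
    intro x
    have h1 : HasDerivAt (fun x : ℝ => k * Real.pi * x) (k * Real.pi) x := by
      simpa using (hasDerivAt_id x).const_mul (k * Real.pi)
    convert! h1.cos using 1; ring
  rw [cosCoeff, intervalIntegral.integral_mul_deriv_eq_deriv_mul (fun x _ => hs x)
    (fun x _ => hf x) (Continuous.intervalIntegrable (by fun_prop) _ _)
    (hf'.intervalIntegrable _ _)]
  simp [h0, h1]

/-! ### The Neumann problem solved by cosine series. -/

/-- The `k`-th time coefficient of the Neumann problem with boundary flux `q`. -/
noncomputable def mode (q : ℝ → ℝ) (k : ℕ) (t : ℝ) : ℝ := duhamel ((k * Real.pi) ^ 2) q t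

/-- The solution of the heat equation with zero initial value, `z_x(0,t) = 0` and
`z_x(1,t) = q(t)`, as a cosine series. -/
noncomputable def neumannState (q : ℝ → ℝ) (x t : ℝ) : ℝ :=
  ∑' k, endWeight k * (Real.cos (k * Real.pi * x) * mode q k t)

section NeumannState

variable {q : ℝ → ℝ} {C T : ℝ}

/-- The factor `exp T` is the price for `(kπ)² + 1` in place of `(kπ)²`, which keeps the bound
meaningful at `k = 0`. -/
lemma abs_mode_le (hC : ∀ t, |q t| ≤ C) {t : ℝ} (ht : t ∈ Icc 0 T) (k : ℕ) :
    |mode q k t| ≤ Real.exp T * C / ((k * Real.pi) ^ 2 + 1) :=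
  abs_duhamel_le' (by positivity) ht hC

lemma continuous_mode (hq : Measurable q) (hC : ∀ t, |q t| ≤ C) (k : ℕ) :
    Continuous (mode q k) :=
  continuous_duhamel (intervalIntegrable_of_bounded hq hC) _

lemma abs_neumannTerm_le (hC : ∀ t, |q t| ≤ C) {t : ℝ} (ht : t ∈ Icc 0 T) (k : ℕ) (x : ℝ) :
    |endWeight k * (Real.cos (k * Real.pi * x) * mode q k t)|
      ≤ 2 * (Real.exp T * C) / ((k * Real.pi) ^ 2 + 1) := by
  rw [abs_mul, abs_mul, mul_div_assoc]
  refine mul_le_mul (abs_endWeight_le k) ?_ (by positivity) zero_le_two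
  calc _ ≤ 1 * |mode q k t| :=
        mul_le_mul_of_nonneg_right (Real.abs_cos_le_one _) (abs_nonneg _)
    _ ≤ _ := by rw [one_mul]; exact abs_mode_le hC ht k

lemma summable_neumannTerm (hC : ∀ t, |q t| ≤ C) {t : ℝ} (ht : 0 ≤ t) (x : ℝ) :
    Summable fun k => endWeight k * (Real.cos (k * Real.pi * x) * mode q k t) :=
  Summable.of_norm_bounded (summable_const_div_eigenvalue _)
    fun k => abs_neumannTerm_le hC (T := t) ⟨ht, le_rfl⟩ k x

lemma continuous_neumannTerm (hq : Measurable q) (hC : ∀ t, |q t| ≤ C) (k : ℕ) :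
    Continuous fun p : ℝ × ℝ => endWeight k * (Real.cos (k * Real.pi * p.1) * mode q k p.2) := by
  have := continuous_mode hq hC k
  fun_prop

lemma continuousOn_neumannState (hq : Measurable q) (hC : ∀ t, |q t| ≤ C) (T : ℝ) :
    ContinuousOn (fun p : ℝ × ℝ => neumannState q p.1 p.2) (univ ×ˢ Icc (0 : ℝ) T) :=
  continuousOn_tsum (fun k => (continuous_neumannTerm hq hC k).continuousOn)
    (summable_const_div_eigenvalue (2 * (Real.exp T * C)))
    fun k p hp => abs_neumannTerm_le hC hp.2 k p.1

lemma neumannState_one (q : ℝ → ℝ) (t : ℝ) :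
    neumannState q 1 t = ∑' k, cosWeight k * mode q k t := by
  unfold neumannState
  congr 1; ext k
  rw [mul_one, ← mul_assoc, endWeight_mul_cos]

/-- Termwise integration of the series of `neumannState` against a bounded weight. -/
lemma hasSum_integral_neumannState_mul (hq : Measurable q) (hC : ∀ t, |q t| ≤ C)
    {ψ : ℝ × ℝ → ℝ} (hψ : Continuous ψ) :
    HasSum (fun k => ∫ p in cylinder T,
        endWeight k * (Real.cos (k * Real.pi * p.1) * mode q k p.2) * ψ p)
      (∫ p in cylinder T, neumannState q p.1 p.2 * ψ p) := by
  obtain ⟨D, hD⟩ := (isCompact_Icc.prod isCompact_Icc :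
    IsCompact (Icc (0 : ℝ) 1 ×ˢ Icc (0 : ℝ) T)).exists_bound_of_continuousOn hψ.continuousOn
  have h := hasSum_integral_of_summable_integral_norm (μ := volume.restrict (cylinder T))
    (F := fun (k : ℕ) (p : ℝ × ℝ) =>
      endWeight k * (Real.cos (k * Real.pi * p.1) * mode q k p.2) * ψ p)
    (fun k => integrable_cylinder ((continuous_neumannTerm hq hC k).mul hψ).continuousOn) ?_
  · simp only [tsum_mul_right] at h
    exact h
  · refine Summable.of_nonneg_of_le (fun k => integral_nonneg fun p => norm_nonneg _) (fun k => ?_)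
      ((summable_const_div_eigenvalue (2 * (Real.exp T * C))).mul_right
        (D * (volume.restrict (cylinder T)).real univ))
    rw [← mul_assoc]
    have : ∀ᵐ p ∂(volume.restrict (cylinder T)),
        ‖(‖endWeight k * (Real.cos (k * Real.pi * p.1) * mode q k p.2) * ψ p‖ : ℝ)‖
          ≤ 2 * (Real.exp T * C) / ((k * Real.pi) ^ 2 + 1) * D := by
      filter_upwards [ae_restrict_mem (measurableSet_cylinder T)] with p hp
      rw [norm_norm, norm_mul]
      have hp' := cylinder_subset T hp
      have h1 := abs_neumannTerm_le hC hp'.2 k p.1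
      exact mul_le_mul h1 (hD p hp') (norm_nonneg _) ((abs_nonneg _).trans h1)
    exact (Real.le_norm_self _).trans (norm_integral_le_of_norm_le_const this)

/-- The termwise `x`-derivative of the cosine series of `neumannState`. -/
noncomputable def neumannFlux (q : ℝ → ℝ) (k : ℕ) (p : ℝ × ℝ) : ℝ :=
  -(endWeight k * (k * Real.pi * Real.sin (k * Real.pi * p.1) * mode q k p.2))

lemma continuous_neumannFlux (hq : Measurable q) (hC : ∀ t, |q t| ≤ C) (k : ℕ) :
    Continuous (neumannFlux q k) := by
  have := continuous_mode hq hC k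
  unfold neumannFlux
  fun_prop

lemma integral_neumannFlux_mul_of_ne (hT : 0 ≤ T) (hq : Measurable q) (hC : ∀ t, |q t| ≤ C)
    {j k : ℕ} (hjk : j ≠ k) :
    ∫ p in cylinder T, neumannFlux q j p * neumannFlux q k p = 0 := by
  rw [integral_cylinder hT (integrable_cylinder
    ((continuous_neumannFlux hq hC j).fun_mul (continuous_neumannFlux hq hC k)).continuousOn)]
  have : ∀ t, ∫ x in (0 : ℝ)..1, neumannFlux q j (x, t) * neumannFlux q k (x, t) = 0 := by
    intro t
    have : ∀ x, neumannFlux q j (x, t) * neumannFlux q k (x, t)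
        = (endWeight j * (j * Real.pi * mode q j t) * (endWeight k * (k * Real.pi * mode q k t)))
          * (Real.sin (j * Real.pi * x) * Real.sin (k * Real.pi * x)) := by
      intro x; simp only [neumannFlux]; ring
    simp_rw [this]
    rw [intervalIntegral.integral_const_mul, integral_sin_mul_sin hjk, mul_zero]
  simp_rw [this]; simp

lemma summable_integral_neumannFlux_sq (hC : ∀ t, |q t| ≤ C) :
    Summable fun k => ∫ p in cylinder T, neumannFlux q k p * neumannFlux q k p := by
  have hC0 : 0 ≤ C := (abs_nonneg _).trans (hC 0)
  refine Summable.of_nonneg_of_le (fun k => integral_nonneg fun p => mul_self_nonneg _)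
    (fun k => ?_) ((summable_const_div_eigenvalue ((2 * (Real.exp T * C)) ^ 2)).mul_right
        ((volume.restrict (cylinder T)).real univ))
  refine (Real.le_norm_self _).trans (norm_integral_le_of_norm_le_const ?_)
  filter_upwards [ae_restrict_mem (measurableSet_cylinder T)] with p hp
  have hp' := cylinder_subset T hp
  have h1 := abs_mode_le hC hp'.2 k
  have h2 := abs_endWeight_le k
  have h3 := Real.abs_sin_le_one (k * Real.pi * p.1)
  -- Differentiation costs a factor `kπ`, leaving a bound of order `1/k`: square summable but not
  -- summable. This is why the flux series is summed in `L²` through orthogonality and not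
  -- uniformly.
  have hm : |neumannFlux q k p|
      ≤ k * Real.pi * (2 * (Real.exp T * C) / ((k * Real.pi) ^ 2 + 1)) := by
    rw [neumannFlux, abs_neg, abs_mul, abs_mul, abs_mul, abs_of_nonneg (by positivity :
      (0 : ℝ) ≤ k * Real.pi)]
    calc |endWeight k| * (k * Real.pi * |Real.sin (k * Real.pi * p.1)| * |mode q k p.2|)
        ≤ 2 * (k * Real.pi * 1 * (Real.exp T * C / ((k * Real.pi) ^ 2 + 1))) := by gcongr
      _ = _ := by ring
  rw [norm_mul, Real.norm_eq_abs]
  calc |neumannFlux q k p| * |neumannFlux q k p|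
      ≤ (k * Real.pi * (2 * (Real.exp T * C) / ((k * Real.pi) ^ 2 + 1))) *
        (k * Real.pi * (2 * (Real.exp T * C) / ((k * Real.pi) ^ 2 + 1))) := by gcongr
    _ = (2 * (Real.exp T * C)) ^ 2 / ((k * Real.pi) ^ 2 + 1) *
        ((k * Real.pi) ^ 2 / ((k * Real.pi) ^ 2 + 1)) := by ring
    _ ≤ (2 * (Real.exp T * C)) ^ 2 / ((k * Real.pi) ^ 2 + 1) * 1 := by
        gcongr
        rw [div_le_one (by positivity)]; linarith
    _ = _ := mul_one _

lemma integral_neumannTerm_mul (hT : 0 ≤ T) (hq : Measurable q) (hC : ∀ t, |q t| ≤ C)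
    {ψ : ℝ → ℝ → ℝ} (hψ : Continuous fun p : ℝ × ℝ => ψ p.1 p.2) (k : ℕ) :
    ∫ p in cylinder T, endWeight k * (Real.cos (k * Real.pi * p.1) * mode q k p.2) * ψ p.1 p.2
      = endWeight k * ∫ t in (0 : ℝ)..T, cosCoeff (fun x => ψ x t) k * mode q k t := by
  rw [integral_cylinder hT (integrable_cylinder
    ((continuous_neumannTerm hq hC k).fun_mul hψ).continuousOn), ← intervalIntegral.integral_const_mul]
  congr 1; ext t
  rw [cosCoeff, ← intervalIntegral.integral_mul_const, ← intervalIntegral.integral_const_mul]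
  congr 1; ext x; ring

lemma integral_neumannFlux_mul (hT : 0 ≤ T) (hq : Measurable q) (hC : ∀ t, |q t| ≤ C)
    {ψ : ℝ → ℝ → ℝ} (hψ : Continuous fun p : ℝ × ℝ => ψ p.1 p.2) (k : ℕ) :
    ∫ p in cylinder T, neumannFlux q k p * ψ p.1 p.2
      = -(endWeight k * ∫ t in (0 : ℝ)..T,
        (∫ x in (0 : ℝ)..1, k * Real.pi * Real.sin (k * Real.pi * x) * ψ x t) * mode q k t) := by
  rw [integral_cylinder hT (integrable_cylinder
    ((continuous_neumannFlux hq hC k).fun_mul hψ).continuousOn), ← intervalIntegral.integral_const_mul,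
    ← intervalIntegral.integral_neg]
  congr 1; ext t
  rw [← intervalIntegral.integral_mul_const, ← intervalIntegral.integral_const_mul,
    ← intervalIntegral.integral_neg]
  congr 1; ext x; simp only [neumannFlux]; ring

/-- Cosine coefficients commute with time averages. -/
lemma cosCoeff_integral_mul (hq : Measurable q) (hC : ∀ t, |q t| ≤ C)
    {v : ℝ → ℝ → ℝ} (hv : Continuous fun p : ℝ × ℝ => v p.1 p.2) (k : ℕ) :
    cosCoeff (fun x => ∫ t in (0 : ℝ)..T, q t * v x t) k
      = ∫ t in (0 : ℝ)..T, cosCoeff (fun x => v x t) k * q t := by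
  unfold cosCoeff
  simp_rw [← intervalIntegral.integral_const_mul, ← intervalIntegral.integral_mul_const]
  rw [intervalIntegral_intervalIntegral_swap]
  · congr 1; ext t; congr 1; ext x; ring
  · have h1 : IntegrableOn (fun p : ℝ × ℝ => Real.cos (k * Real.pi * p.1) * v p.1 p.2)
        (uIcc 0 1 ×ˢ uIcc 0 T) :=
      ContinuousOn.integrableOn_compact (isCompact_uIcc.prod isCompact_uIcc)
        (Continuous.continuousOn (by fun_prop))
    have h2 := h1.bdd_mul (f := fun p : ℝ × ℝ => q p.2) (c := C)
      (hq.comp measurable_snd).aestronglyMeasurable (ae_of_all _ fun p => hC p.2)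
    refine IntegrableOn.mono_set (h2.congr (ae_of_all _ fun p => ?_))
      (prod_mono uIoc_subset_uIcc uIoc_subset_uIcc)
    simp only [Function.uncurry]; ring

lemma continuous_integral_mul (hq : Measurable q) (hC : ∀ t, |q t| ≤ C)
    {v : ℝ → ℝ → ℝ} (hv : Continuous fun p : ℝ × ℝ => v p.1 p.2) :
    ContinuousOn (fun x => ∫ t in (0 : ℝ)..T, q t * v x t) (Icc 0 1) := by
  obtain ⟨D, hD⟩ := (isCompact_Icc.prod isCompact_uIcc :
    IsCompact (Icc (0 : ℝ) 1 ×ˢ uIcc (0 : ℝ) T)).exists_bound_of_continuousOn hv.continuousOn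
  intro x₀ hx₀
  refine intervalIntegral.continuousWithinAt_of_dominated_interval (bound := fun _ => C * D)
    (Filter.Eventually.of_forall fun x => ?_) ?_ intervalIntegrable_const ?_
  · exact (hq.aestronglyMeasurable.mul (hv.comp
      (by fun_prop : Continuous fun t : ℝ => (x, t))).aestronglyMeasurable)
  · filter_upwards [self_mem_nhdsWithin] with x hx
    refine ae_of_all _ fun t ht => ?_
    rw [norm_mul]
    exact mul_le_mul (hC t) (hD (x, t) ⟨hx, uIoc_subset_uIcc ht⟩) (norm_nonneg _)
      ((abs_nonneg _).trans (hC t))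
  · refine ae_of_all _ fun t _ => ?_
    exact (continuous_const.mul (hv.comp
      (by fun_prop : Continuous fun x : ℝ => (x, t)))).continuousWithinAt

/-- Termwise integration of `neumannState` at a fixed time. -/
lemma hasSum_integral_neumannState_slice (hC : ∀ t, |q t| ≤ C) {t : ℝ} (ht : 0 ≤ t) {f : ℝ → ℝ}
    (hf : ContinuousOn f (Icc 0 1)) :
    HasSum (fun k => endWeight k * (cosCoeff f k * mode q k t))
      (∫ x in (0 : ℝ)..1, neumannState q x t * f x) := by
  obtain ⟨D, hD⟩ := isCompact_Icc.exists_bound_of_continuousOn hf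
  have hu : uIcc (0 : ℝ) 1 = Icc 0 1 := uIcc_of_le zero_le_one
  have h := intervalIntegral.hasSum_integral_of_dominated_convergence (a := 0) (b := 1)
    (μ := volume)
    (F := fun (k : ℕ) (x : ℝ) => endWeight k * (Real.cos (k * Real.pi * x) * mode q k t) * f x)
    (f := fun x => neumannState q x t * f x)
    (fun k _ => 2 * (Real.exp t * C) / ((k * Real.pi) ^ 2 + 1) * D) ?_ ?_ ?_ ?_ ?_
  · convert! h using 1
    ext k
    rw [cosCoeff, ← intervalIntegral.integral_mul_const, ← intervalIntegral.integral_const_mul]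
    congr 1; ext x; ring
  · intro k
    refine ContinuousOn.aestronglyMeasurable ?_ measurableSet_uIoc
    refine ContinuousOn.mul (Continuous.continuousOn (by fun_prop)) (hf.mono ?_)
    rw [← hu]; exact uIoc_subset_uIcc
  · refine fun k => ae_of_all _ fun x hx => ?_
    rw [norm_mul]
    have h1 := abs_neumannTerm_le hC (T := t) ⟨ht, le_rfl⟩ k x
    exact mul_le_mul h1 (hD x (hu ▸ uIoc_subset_uIcc hx)) (norm_nonneg _) ((abs_nonneg _).trans h1)
  · exact ae_of_all _ fun x _ => (summable_const_div_eigenvalue _).mul_right _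
  · exact intervalIntegrable_const
  · exact ae_of_all _ fun x _ => (summable_neumannTerm hC ht x).hasSum.mul_right _

/-- The cosine series solves the Neumann problem. -/
theorem isState_neumannState (hT : 0 ≤ T) (hq : Measurable q) (hC : ∀ t, |q t| ≤ C) :
    IsState T 0 q (neumannState q) := by
  have hqi := intervalIntegrable_of_bounded hq hC
  refine ⟨(continuousOn_neumannState hq hC T).mono (prod_mono (subset_univ _) subset_rfl), ?_, ?_⟩
  · intro x _
    simp [neumannState, mode, duhamel_zero]
  obtain ⟨g, hg, hgs⟩ := exists_memLp_hasSum_integral_mul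
    (fun k => memLp_cylinder (T := T) (continuous_neumannFlux hq hC k).continuousOn 2)
    (fun j k hjk => integral_neumannFlux_mul_of_ne hT hq hC hjk)
    (summable_integral_neumannFlux_sq hC)
  refine ⟨fun x t => g (x, t), ⟨hg, ?_⟩, ?_⟩
  · intro η hη _ hsupp
    have hη0 : ∀ x t, (x, t) ∉ cylinder T → η x t = 0 := fun x t h =>
      image_eq_zero_of_notMem_tsupport (f := fun p : ℝ × ℝ => η p.1 p.2) (fun h' => h (hsupp h'))
    have h1 := hasSum_integral_neumannState_mul (T := T) hq hC (continuous_deriv_fst hη)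
    have h2 := (hgs _ (memLp_cylinder hη.continuous.continuousOn 2)).neg
    refine h1.unique ?_
    convert! h2 using 1
    ext k
    rw [integral_neumannTerm_mul hT hq hC (ψ := fun x t => deriv (fun x => η x t) x)
      (continuous_deriv_fst hη), integral_neumannFlux_mul hT hq hC hη.continuous, neg_neg]
    congr 2; ext t; congr 1
    have hd : ∀ x, HasDerivAt (fun x => η x t) (deriv (fun x => η x t) x) x := fun x =>
      (hasDerivAt_fst hη x t).differentiableAt.hasDerivAt
    exact cosCoeff_deriv hd ((continuous_deriv_fst hη).comp
      (by fun_prop : Continuous fun x : ℝ => (x, t))) (hη0 0 t fun h => lt_irrefl _ h.1.1)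
      (hη0 1 t fun h => lt_irrefl _ h.1.2) k
  · intro v hv
    have h1 := hasSum_integral_neumannState_slice (t := T) hC hT
      (hv.continuous.comp (by fun_prop : Continuous fun x : ℝ => (x, T))).continuousOn
    have h2 := hasSum_integral_neumannState_mul (T := T) hq hC (continuous_deriv_snd hv)
    have h3 := hgs _ (memLp_cylinder (continuous_deriv_fst hv).continuousOn 2)
    have hsum := (h1.sub h2).add h3
    have hW := continuous_integral_mul (T := T) hq hC hv.continuous
    -- By the equation for `mode q k`, the `k`-th contribution to the left-hand side collapses to
    -- the `k`-th coefficient of the time average `W(x) = ∫ q(t) v(x,t) dt`. The sum is therefore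
    -- the cosine series of `W` at `x = 1`, which is the boundary term.
    have hterm : HasSum (fun k => endWeight k *
        cosCoeff (fun x => ∫ t in (0 : ℝ)..T, q t * v x t) k)
        ((∫ x in (0 : ℝ)..1, neumannState q x T * v x T)
          - (∫ p in cylinder T, neumannState q p.1 p.2 * deriv (fun t => v p.1 t) p.2)
          + ∫ p in cylinder T, g p * deriv (fun x => v x p.2) p.1) := by
      convert! hsum using 1
      ext k
      rw [integral_neumannTerm_mul hT hq hC (ψ := fun x t => deriv (fun t => v x t) t)
        (continuous_deriv_snd hv), integral_neumannFlux_mul hT hq hC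
        (ψ := fun x t => deriv (fun x => v x t) x) (continuous_deriv_fst hv),
        cosCoeff_integral_mul hq hC hv.continuous]
      have hd : ∀ t x, HasDerivAt (fun x => v x t) (deriv (fun x => v x t) x) x := fun t x =>
        (hasDerivAt_fst hv x t).differentiableAt.hasDerivAt
      have hdc : ∀ t, Continuous fun x => deriv (fun x => v x t) x := fun t =>
        (continuous_deriv_fst hv).comp (by fun_prop : Continuous fun x : ℝ => (x, t))
      simp_rw [integral_sin_mul_deriv (hd _) (hdc _)]
      have hVc := continuous_cosCoeff hv.continuous k
      have hVc' := continuous_cosCoeff (f := fun x t => deriv (fun t => v x t) t)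
        (continuous_deriv_snd hv) k
      have hmc := continuous_mode hq hC k
      have hparts := mul_duhamel_eq hqi ((k * Real.pi) ^ 2) T
        (hasDerivAt_cosCoeff hv k) hVc'
      have hsplit : ∫ t in (0 : ℝ)..T, (cosCoeff (fun x => deriv (fun t => v x t) t) k
            - (k * Real.pi) ^ 2 * cosCoeff (fun x => v x t) k) * duhamel ((k * Real.pi) ^ 2) q t
          = (∫ t in (0 : ℝ)..T, cosCoeff (fun x => deriv (fun t => v x t) t) k * mode q k t)
            + ∫ t in (0 : ℝ)..T, -((k * Real.pi) ^ 2 * cosCoeff (fun x => v x t) k) * mode q k t := by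
        have hc1 : Continuous fun t =>
            cosCoeff (fun x => deriv (fun t => v x t) t) k * mode q k t := hVc'.fun_mul hmc
        have hc2 : Continuous fun t =>
            -((k * Real.pi) ^ 2 * cosCoeff (fun x => v x t) k) * mode q k t := by fun_prop
        rw [← intervalIntegral.integral_add (hc1.intervalIntegrable _ _)
          (hc2.intervalIntegrable _ _)]
        congr 1; ext t; simp only [mode]; ring
      rw [hsplit] at hparts
      change _ = endWeight k * (cosCoeff (fun x => v x T) k * duhamel ((k * Real.pi) ^ 2) q T)
        - _ + _
      rw [hparts]; ring
    -- Summability of the coefficients of `W` is not estimated; it is inherited from the convergence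
    -- in `hterm`, since the weights have modulus at least one.
    have hcs : Summable (cosCoeff (fun x => ∫ t in (0 : ℝ)..T, q t * v x t)) := by
      refine Summable.of_norm_bounded hterm.summable.norm fun k => ?_
      rw [norm_mul]
      exact le_mul_of_one_le_left (norm_nonneg _) (one_le_abs_endWeight k)
    have hone := hasSum_cosCoeff hW hcs
    rw [zero_mul, add_zero]
    exact hterm.unique hone

end NeumannState

/-! ### From Neumann to Robin: the boundary feedback as a fixed point. -/

lemma duhamel_sub {q r : ℝ → ℝ} (hq : ∀ a b, IntervalIntegrable q volume a b)
    (hr : ∀ a b, IntervalIntegrable r volume a b) (m t : ℝ) :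
    duhamel m q t - duhamel m r t = duhamel m (fun s => q s - r s) t := by
  rw [duhamel, duhamel, duhamel, ← intervalIntegral.integral_sub
    ((hq 0 t).continuousOn_mul (by fun_prop)) ((hr 0 t).continuousOn_mul (by fun_prop))]
  congr 1; ext s; ring

lemma duhamel_congr {q r : ℝ → ℝ} {t : ℝ} (ht : 0 ≤ t) (h : ∀ s ∈ Icc 0 t, q s = r s) (m : ℝ) :
    duhamel m q t = duhamel m r t := by
  refine intervalIntegral.integral_congr fun s hs => ?_
  rw [uIcc_of_le ht] at hs
  simp only [h s hs]

/-- Each term tends to zero as `γ → ∞`, and the terms with `γ = 1` dominate. -/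
lemma exists_tsum_eigenvalue_le {ε : ℝ} (hε : 0 < ε) :
    ∃ γ : ℝ, 0 < γ ∧ ∑' k : ℕ, 1 / ((k * Real.pi) ^ 2 + γ) ≤ ε := by
  have h : Filter.Tendsto (fun γ : ℝ => ∑' k : ℕ, 1 / ((k * Real.pi) ^ 2 + γ)) Filter.atTop
      (nhds (∑' _ : ℕ, (0 : ℝ))) := by
    refine tendsto_tsum_of_dominated_convergence (summable_inv_eigenvalue zero_lt_one)
      (fun k => ?_) ?_
    · exact tendsto_const_nhds.div_atTop (Filter.tendsto_atTop_add_const_left _ _ Filter.tendsto_id)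
    · filter_upwards [Filter.eventually_ge_atTop 1] with γ hγ k
      have hk : (0 : ℝ) ≤ (k * Real.pi) ^ 2 := by positivity
      rw [Real.norm_of_nonneg (by positivity)]
      exact one_div_le_one_div_of_le (by positivity) (by linarith)
  rw [tsum_zero] at h
  obtain ⟨γ, h1, h2⟩ := ((h.eventually (ge_mem_nhds hε)).and (Filter.eventually_gt_atTop 0)).exists
  exact ⟨γ, h2, h1⟩

section Fixpoint

variable {r : ℝ → ℝ} {R γ : ℝ}

lemma abs_weighted_duhamel_le (hγ : 0 < γ) (hR : ∀ t, |r t| ≤ R) (k : ℕ) {t : ℝ} (ht : 0 ≤ t) :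
    |cosWeight k * duhamel ((k * Real.pi) ^ 2 + γ) r t|
      ≤ 2 * R * (1 / ((k * Real.pi) ^ 2 + γ)) := by
  rw [abs_mul, abs_of_nonneg (cosWeight_nonneg k), mul_assoc, mul_one_div]
  exact mul_le_mul (cosWeight_le k)
    (abs_duhamel_le (by positivity) ht fun s _ => hR s) (abs_nonneg _) zero_le_two

lemma summable_weighted_duhamel (hγ : 0 < γ) (hR : ∀ t, |r t| ≤ R) {t : ℝ} (ht : 0 ≤ t) :
    Summable fun k : ℕ => cosWeight k * duhamel ((k * Real.pi) ^ 2 + γ) r t :=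
  Summable.of_norm_bounded ((summable_inv_eigenvalue hγ).mul_left (2 * R))
    fun k => abs_weighted_duhamel_le hγ hR k ht

lemma abs_tsum_weighted_duhamel_le (hγ : 0 < γ) (hR : ∀ t, |r t| ≤ R) {t : ℝ} (ht : 0 ≤ t) :
    |∑' k : ℕ, cosWeight k * duhamel ((k * Real.pi) ^ 2 + γ) r t|
      ≤ 2 * R * ∑' k : ℕ, 1 / ((k * Real.pi) ^ 2 + γ) := by
  rw [← Real.norm_eq_abs]
  exact tsum_of_norm_bounded ((summable_inv_eigenvalue hγ).hasSum.mul_left (2 * R))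
    fun k => abs_weighted_duhamel_le hγ hR k ht

lemma continuous_tsum_weighted_duhamel (hγ : 0 < γ) (hr : Measurable r) (hR : ∀ t, |r t| ≤ R) :
    Continuous fun t => ∑' k : ℕ,
      cosWeight k * duhamel ((k * Real.pi) ^ 2 + γ) r (max t 0) := by
  refine continuous_tsum (fun k => ?_) ((summable_inv_eigenvalue hγ).mul_left (2 * R))
    fun k t => abs_weighted_duhamel_le hγ hR k (le_max_right t 0)
  have := continuous_duhamel (intervalIntegrable_of_bounded hr hR) ((k * Real.pi) ^ 2 + γ)
  fun_prop

/-- The boundary feedback equation `f = Σ wₖ Dₖ (H - α f)`, where `Dₖ` is the Duhamel operator of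
the shifted `k`-th Neumann eigenvalue, is solvable for large shifts. -/
theorem exists_feedback_fixpoint {H : ℝ → ℝ} (hH : Measurable H) {M : ℝ} (hM : ∀ t, |H t| ≤ M)
    {α : ℝ} (hα : 0 ≤ α) (hγ : 0 < γ)
    (hsmall : ∑' k : ℕ, 1 / ((k * Real.pi) ^ 2 + γ) ≤ 1 / (4 * (α + 1))) :
    ∃ f : BoundedContinuousFunction ℝ ℝ, ∀ t, 0 ≤ t →
      f t = ∑' k : ℕ, cosWeight k * duhamel ((k * Real.pi) ^ 2 + γ) (fun s => H s - α * f s) t := by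
  have hrm : ∀ f : BoundedContinuousFunction ℝ ℝ, Measurable fun s => H s - α * f s := fun f =>
    hH.sub (f.continuous.measurable.const_mul α)
  have hrb : ∀ (f : BoundedContinuousFunction ℝ ℝ) s, |H s - α * f s| ≤ M + α * ‖f‖ := by
    intro f s
    refine (abs_sub _ _).trans (add_le_add (hM s) ?_)
    rw [abs_mul, abs_of_nonneg hα]
    exact mul_le_mul_of_nonneg_left (f.norm_coe_le_norm s) hα
  -- Clamping time by `max t 0` lets the operator act on bounded continuous functions on the whole
  -- line; `γ > 0` also makes the bound on the `k = 0` term uniform in time.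
  let Φ : BoundedContinuousFunction ℝ ℝ → BoundedContinuousFunction ℝ ℝ := fun f =>
    BoundedContinuousFunction.ofNormedAddCommGroup
      (fun t => ∑' k : ℕ, cosWeight k *
        duhamel ((k * Real.pi) ^ 2 + γ) (fun s => H s - α * f s) (max t 0))
      (continuous_tsum_weighted_duhamel hγ (hrm f) (hrb f))
      (2 * (M + α * ‖f‖) * ∑' k : ℕ, 1 / ((k * Real.pi) ^ 2 + γ))
      (fun t => abs_tsum_weighted_duhamel_le hγ (hrb f) (le_max_right t 0))
  have hΦ : ContractingWith (1 / 2) Φ := by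
    refine ⟨by rw [← NNReal.coe_lt_coe]; norm_num, LipschitzWith.of_dist_le_mul fun f g => ?_⟩
    rw [BoundedContinuousFunction.dist_le (by positivity)]
    intro t
    have ht := le_max_right t (0 : ℝ)
    have hd : ∀ s, |(H s - α * f s) - (H s - α * g s)| ≤ α * dist f g := by
      intro s
      rw [show (H s - α * f s) - (H s - α * g s) = -(α * (f s - g s)) by ring, abs_neg, abs_mul,
        abs_of_nonneg hα]
      rw [← Real.dist_eq]
      exact mul_le_mul_of_nonneg_left (BoundedContinuousFunction.dist_coe_le_dist s) hα
    have heq : Φ f t - Φ g t = ∑' k : ℕ, cosWeight k * duhamel ((k * Real.pi) ^ 2 + γ)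
        (fun s => (H s - α * f s) - (H s - α * g s)) (max t 0) := by
      change (∑' k : ℕ, _) - (∑' k : ℕ, _) = _
      rw [← (summable_weighted_duhamel hγ (hrb f) ht).tsum_sub
        (summable_weighted_duhamel hγ (hrb g) ht)]
      congr 1; ext k
      rw [← duhamel_sub (intervalIntegrable_of_bounded (hrm f) (hrb f))
        (intervalIntegrable_of_bounded (hrm g) (hrb g)), mul_sub]
    rw [Real.dist_eq, heq]
    refine (abs_tsum_weighted_duhamel_le hγ hd ht).trans ?_
    -- The `2` is the bound on `cosWeight`; the smallness threshold `1 / (4 (α + 1))` is chosen to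
    -- give the factor `1/2`.
    calc 2 * (α * dist f g) * ∑' k : ℕ, 1 / ((k * Real.pi) ^ 2 + γ)
        ≤ 2 * (α * dist f g) * (1 / (4 * (α + 1))) :=
          mul_le_mul_of_nonneg_left hsmall (by positivity)
      _ = (1 / 2) * (α / (α + 1)) * dist f g := by field_simp; ring
      _ ≤ (1 / 2) * 1 * dist f g := by
          gcongr
          rw [div_le_one (by positivity)]; linarith
      _ = _ := by push_cast; ring
  refine ⟨hΦ.fixedPoint Φ, fun t ht => ?_⟩
  conv_lhs => rw [← hΦ.fixedPoint_isFixedPt]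
  change ∑' k : ℕ, _ = _
  rw [max_eq_left ht]

end Fixpoint

/-- For every bounded boundary datum `h` there is a Neumann flux `q` whose state satisfies the
Robin condition `q = h - α z(1,·)`. -/
theorem exists_neumann_flux {h : ℝ → ℝ} (hh : Measurable h) {M : ℝ} (hM : ∀ t, |h t| ≤ M)
    {α : ℝ} (hα : 0 ≤ α) (T : ℝ) :
    ∃ q : ℝ → ℝ, Measurable q ∧ (∃ C, ∀ t, |q t| ≤ C) ∧
      ∀ t ∈ Icc 0 T, q t = h t - α * neumannState q 1 t := by
  obtain ⟨γ, hγ, hsmall⟩ := exists_tsum_eigenvalue_le (ε := 1 / (4 * (α + 1))) (by positivity)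
  have hM0 : 0 ≤ M := (abs_nonneg _).trans (hM 0)
  -- The fixed point `f` will be `exp(-γt) z(1,t)`. The absolute value in the exponent only keeps
  -- `H` bounded at negative times.
  set H : ℝ → ℝ := fun s => Real.exp (-γ * |s|) * h s with hHdef
  have hHm : Measurable H := (by fun_prop : Measurable fun s : ℝ => Real.exp (-γ * |s|)).mul hh
  have hHb : ∀ t, |H t| ≤ M := by
    intro t
    rw [hHdef, abs_mul, abs_of_pos (Real.exp_pos _)]
    calc _ ≤ 1 * M := mul_le_mul (Real.exp_le_one_iff.2 (by
            rw [neg_mul, neg_nonpos]; positivity)) (hM t) (abs_nonneg _) zero_le_one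
      _ = M := one_mul M
  obtain ⟨f, hf⟩ := exists_feedback_fixpoint hHm hHb hα hγ hsmall
  -- Undoing the weight produces the unbounded factor `exp(γt)`, so the flux is truncated to
  -- `[0,T]`; Duhamel integrals up to `t ≤ T` do not see the truncation.
  set q : ℝ → ℝ := (Icc 0 T).indicator fun t => h t - α * (Real.exp (γ * t) * f t) with hqdef
  have hqI : ∀ t ∈ Icc 0 T, q t = h t - α * (Real.exp (γ * t) * f t) := fun t ht =>
    indicator_of_mem ht _
  have hfm := f.continuous.measurable
  refine ⟨q, ?_, ⟨M + α * (Real.exp (γ * T) * ‖f‖), fun t => ?_⟩, fun t ht => ?_⟩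
  · exact Measurable.indicator (by fun_prop) measurableSet_Icc
  · by_cases ht : t ∈ Icc 0 T
    · rw [hqI t ht]
      refine (abs_sub _ _).trans (add_le_add (hM t) ?_)
      rw [abs_mul, abs_mul, abs_of_nonneg hα, abs_of_pos (Real.exp_pos _)]
      have := f.norm_coe_le_norm t
      rw [Real.norm_eq_abs] at this
      have := ht.2
      gcongr
    · rw [hqdef, indicator_of_notMem ht, abs_zero]; positivity
  · rw [hqI t ht, neumannState_one, hf t ht.1]
    congr 2
    rw [← tsum_mul_left]
    congr 1; ext k
    rw [mode, duhamel_shift _ γ q]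
    rw [duhamel_congr (q := fun s => Real.exp (-γ * s) * q s) (r := fun s => H s - α * f s) ht.1]
    · ring
    · intro s hs
      rw [hqI s ⟨hs.1, hs.2.trans ht.2⟩, hHdef]
      simp only [abs_of_nonneg hs.1]
      have : Real.exp (-γ * s) * Real.exp (γ * s) = 1 := by rw [← Real.exp_add]; simp
      linear_combination (-α * f s) * this

/-- A Neumann state with flux `h - α z(1,·)` is a Robin state with datum `h`. -/
lemma IsState.robin {T α : ℝ} (hT : 0 ≤ T) {q h : ℝ → ℝ} {z : ℝ → ℝ → ℝ} (hz : IsState T 0 q z)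
    (hhi : IntervalIntegrable h volume 0 T)
    (hq : ∀ t ∈ Icc 0 T, q t = h t - α * z 1 t) : IsState T α h z := by
  obtain ⟨g, hg, hw⟩ := hz.weak
  refine ⟨hz.continuousOn, hz.initial, g, hg, fun v hv => ?_⟩
  have hvc : Continuous fun t => v 1 t :=
    hv.continuous.comp (by fun_prop : Continuous fun t : ℝ => ((1 : ℝ), t))
  have hzc : ContinuousOn (fun t => z 1 t) (uIcc 0 T) := by
    rw [uIcc_of_le hT]
    exact continuousOn_trace hz.continuousOn
  have h1 : ∫ t in (0 : ℝ)..T, q t * v 1 t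
      = (∫ t in (0 : ℝ)..T, h t * v 1 t) - α * ∫ t in (0 : ℝ)..T, z 1 t * v 1 t := by
    rw [← intervalIntegral.integral_const_mul, ← intervalIntegral.integral_sub
      (hhi.mul_continuousOn hvc.continuousOn)
      ((hzc.fun_mul hvc.continuousOn).intervalIntegrable.const_mul α)]
    refine intervalIntegral.integral_congr fun t ht => ?_
    rw [uIcc_of_le hT] at ht
    simp only [hq t ht]; ring
  have := hw v hv
  rw [h1] at this
  linarith

/-! ### Cutoffs, and test functions for the weak derivative without compact support. -/

/-- A smooth cutoff on `(0,L)`, equal to one at distance `2/n` from the end points. -/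
noncomputable def cutoff (L : ℝ) (n : ℕ) (x : ℝ) : ℝ :=
  Real.smoothTransition (n * x - 1) * Real.smoothTransition (n * (L - x) - 1)

lemma contDiff_cutoff (L : ℝ) (n : ℕ) : ContDiff ℝ 1 (cutoff L n) := by
  unfold cutoff
  exact (Real.smoothTransition.contDiff.comp (by fun_prop)).mul
    (Real.smoothTransition.contDiff.comp (by fun_prop))

lemma abs_cutoff_le (L : ℝ) (n : ℕ) (x : ℝ) : |cutoff L n x| ≤ 1 := by
  unfold cutoff
  rw [abs_mul, abs_of_nonneg (Real.smoothTransition.nonneg _),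
    abs_of_nonneg (Real.smoothTransition.nonneg _)]
  exact mul_le_one₀ (Real.smoothTransition.le_one _) (Real.smoothTransition.nonneg _)
    (Real.smoothTransition.le_one _)

lemma cutoff_eq_zero {L : ℝ} {n : ℕ} (hn : 0 < n) {x : ℝ}
    (hx : x ∉ Icc (1 / (n : ℝ)) (L - 1 / n)) : cutoff L n x = 0 := by
  have hn' : (0 : ℝ) < n := Nat.cast_pos.2 hn
  rw [mem_Icc, not_and_or, not_le, not_le] at hx
  unfold cutoff
  rcases hx with h | h
  · rw [Real.smoothTransition.zero_of_nonpos, zero_mul]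
    rw [lt_div_iff₀ hn'] at h; linarith
  · rw [Real.smoothTransition.zero_of_nonpos (x := n * (L - x) - 1), mul_zero]
    have : L - x < 1 / n := by linarith
    rw [lt_div_iff₀ hn'] at this; linarith

/-- Equality holds on a neighbourhood and not only at `x`, so that derivatives agree as well. -/
lemma eventually_cutoff_eq_one {L x : ℝ} (hx : x ∈ Ioo 0 L) :
    ∀ᶠ n : ℕ in Filter.atTop, cutoff L n =ᶠ[nhds x] fun _ => 1 := by
  have h1 : 0 < x := hx.1
  have h2 : 0 < L - x := sub_pos.2 hx.2
  -- With `n x ≥ 4`, every `y > x/2` satisfies `n y - 1 ≥ 1`; the other end is symmetric.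
  filter_upwards [Filter.eventually_ge_atTop ⌈4 / x⌉₊, Filter.eventually_ge_atTop ⌈4 / (L - x)⌉₊]
    with n hn1 hn2
  have hn1' := Nat.ceil_le.1 hn1
  have hn2' := Nat.ceil_le.1 hn2
  rw [div_le_iff₀ h1] at hn1'
  rw [div_le_iff₀ h2] at hn2'
  have hn0 : (0 : ℝ) ≤ n := Nat.cast_nonneg n
  filter_upwards [Ioo_mem_nhds (by linarith : x / 2 < x) (by linarith : x < (L + x) / 2)] with y hy
  unfold cutoff
  rw [Real.smoothTransition.one_of_one_le, Real.smoothTransition.one_of_one_le, mul_one]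
  · nlinarith [hy.2]
  · nlinarith [hy.1]

/-- The derivative lives on `1 ≤ y ≤ 2`. With `y = n · dist`, the bound says that the cutoff's
derivative, of order `n` in a layer of width `2/n`, is harmless after multiplication by the distance
to the end point. -/
lemma exists_bound_mul_deriv_smoothTransition :
    ∃ D : ℝ, ∀ y : ℝ, |y * deriv Real.smoothTransition (y - 1)| ≤ D := by
  have hc : Continuous (deriv Real.smoothTransition) :=
    (Real.smoothTransition.contDiff (n := 1)).continuous_deriv le_rfl
  have hs : HasCompactSupport fun y : ℝ => y * deriv Real.smoothTransition (y - 1) := by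
    refine HasCompactSupport.intro (isCompact_Icc (a := (1 : ℝ)) (b := 2)) fun y hy => ?_
    rw [mem_Icc, not_and_or, not_le, not_le] at hy
    have : deriv Real.smoothTransition (y - 1) = 0 := by
      rcases hy with h | h
      · have : Real.smoothTransition =ᶠ[nhds (y - 1)] fun _ => 0 := by
          filter_upwards [Iio_mem_nhds (by linarith : y - 1 < 0)] with z hz
          exact Real.smoothTransition.zero_of_nonpos hz.le
        rw [this.deriv_eq, deriv_const]
      · have : Real.smoothTransition =ᶠ[nhds (y - 1)] fun _ => 1 := by
          filter_upwards [Ioi_mem_nhds (by linarith : 1 < y - 1)] with z hz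
          exact Real.smoothTransition.one_of_one_le (le_of_lt hz)
        rw [this.deriv_eq, deriv_const]
    rw [this, mul_zero]
  obtain ⟨D, hD⟩ := hs.exists_bound_of_continuous (by fun_prop)
  exact ⟨D, hD⟩

lemma hasDerivAt_cutoff (L : ℝ) (n : ℕ) (x : ℝ) :
    HasDerivAt (cutoff L n)
      (n * deriv Real.smoothTransition (n * x - 1) * Real.smoothTransition (n * (L - x) - 1)
        - Real.smoothTransition (n * x - 1)
          * (n * deriv Real.smoothTransition (n * (L - x) - 1))) x := by
  have hS : ∀ y, HasDerivAt Real.smoothTransition (deriv Real.smoothTransition y) y := fun y =>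
    ((Real.smoothTransition.contDiff (n := 1)).differentiable one_ne_zero y).hasDerivAt
  have h1 : HasDerivAt (fun x : ℝ => n * x - 1) (n : ℝ) x := by
    simpa using ((hasDerivAt_id x).const_mul (n : ℝ)).sub_const 1
  have h2 : HasDerivAt (fun x : ℝ => n * (L - x) - 1) (-(n : ℝ)) x := by
    simpa using (((hasDerivAt_id x).const_sub L).const_mul (n : ℝ)).sub_const 1
  convert! ((hS _).comp x h1).mul ((hS _).comp x h2) using 1
  simp only [Function.comp]; ring

/-- The derivatives of `ζ · cutoff` are bounded uniformly in `n` if `ζ` vanishes at both ends. -/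
lemma exists_bound_deriv_mul_cutoff {ζ : ℝ → ℝ} (hζ : ContDiff ℝ 1 ζ) (h0 : ζ 0 = 0)
    (h1 : ζ 1 = 0) :
    ∃ B : ℝ, ∀ (n : ℕ), ∀ x ∈ Icc (0 : ℝ) 1, |deriv (fun x => ζ x * cutoff 1 n x) x| ≤ B := by
  obtain ⟨D, hD⟩ := exists_bound_mul_deriv_smoothTransition
  obtain ⟨K, hK⟩ := (isCompact_Icc (a := (0 : ℝ)) (b := 1)).exists_bound_of_continuousOn
    (hζ.continuous_deriv le_rfl).continuousOn
  have hζd : ∀ x, HasDerivAt ζ (deriv ζ x) x := fun x =>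
    (hζ.differentiable one_ne_zero x).hasDerivAt
  have hlip : ∀ x ∈ Icc (0 : ℝ) 1, ∀ y ∈ Icc (0 : ℝ) 1, |ζ y - ζ x| ≤ K * |y - x| :=
    fun x hx y hy => (convex_Icc (0 : ℝ) 1).norm_image_sub_le_of_norm_hasDerivWithin_le
      (fun z _ => (hζd z).hasDerivWithinAt) hK hx hy
  refine ⟨K + 2 * (K * D), fun n x hx => ?_⟩
  -- Vanishing at the ends bounds `ζ` by `K` times the distance to either end, which offsets the
  -- growth of the cutoff's derivative.
  have hl0 : |ζ x| ≤ K * x := by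
    simpa [h0, abs_of_nonneg hx.1] using hlip 0 (by norm_num) x hx
  have hl1 : |ζ x| ≤ K * (1 - x) := by
    simpa [h1, abs_sub_comm x 1, abs_of_nonneg (sub_nonneg.2 hx.2)] using hlip 1 (by norm_num) x hx
  have hK0 : 0 ≤ K := (norm_nonneg _).trans (hK x hx)
  rw [((hζd x).fun_mul (hasDerivAt_cutoff 1 n x)).deriv]
  have hn0 : (0 : ℝ) ≤ n := Nat.cast_nonneg n
  have key : ∀ y, 0 ≤ y → |ζ x| ≤ K * y →
      |ζ x * (n * deriv Real.smoothTransition (n * y - 1))| ≤ K * D := by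
    intro y hy hzy
    have := hD (n * y)
    rw [abs_mul, abs_of_nonneg (by positivity)] at this
    rw [abs_mul, abs_mul, abs_of_nonneg hn0]
    calc |ζ x| * (n * |deriv Real.smoothTransition (n * y - 1)|)
        ≤ K * y * (n * |deriv Real.smoothTransition (n * y - 1)|) := by gcongr
      _ = K * (n * y * |deriv Real.smoothTransition (n * y - 1)|) := by ring
      _ ≤ K * D := by gcongr
  have hs : ∀ y, |Real.smoothTransition y| ≤ 1 := fun y => by
    rw [abs_of_nonneg (Real.smoothTransition.nonneg y)]; exact Real.smoothTransition.le_one y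
  have k1 := key x hx.1 hl0
  have k2 := key (1 - x) (sub_nonneg.2 hx.2) hl1
  have e : ζ x * (n * deriv Real.smoothTransition (n * x - 1)
        * Real.smoothTransition (n * (1 - x) - 1)
      - Real.smoothTransition (n * x - 1) * (n * deriv Real.smoothTransition (n * (1 - x) - 1)))
      = ζ x * (n * deriv Real.smoothTransition (n * x - 1))
          * Real.smoothTransition (n * (1 - x) - 1)
        - ζ x * (n * deriv Real.smoothTransition (n * (1 - x) - 1))
          * Real.smoothTransition (n * x - 1) := by ring
  rw [e]
  have hKD : 0 ≤ K * D := (abs_nonneg _).trans k1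
  have b1 : |deriv ζ x * cutoff 1 n x| ≤ K := by
    rw [abs_mul]
    calc _ ≤ K * 1 := mul_le_mul (hK x hx) (abs_cutoff_le 1 n x) (abs_nonneg _) hK0
      _ = K := mul_one K
  have b2 : |ζ x * (n * deriv Real.smoothTransition (n * x - 1))
      * Real.smoothTransition (n * (1 - x) - 1)| ≤ K * D := by
    rw [abs_mul]
    calc _ ≤ K * D * 1 := mul_le_mul k1 (hs _) (abs_nonneg _) hKD
      _ = K * D := mul_one _
  have b3 : |ζ x * (n * deriv Real.smoothTransition (n * (1 - x) - 1))
      * Real.smoothTransition (n * x - 1)| ≤ K * D := by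
    rw [abs_mul]
    calc _ ≤ K * D * 1 := mul_le_mul k2 (hs _) (abs_nonneg _) hKD
      _ = K * D := mul_one _
  refine (abs_add_le _ _).trans ?_
  have := abs_sub (ζ x * (n * deriv Real.smoothTransition (n * x - 1))
      * Real.smoothTransition (n * (1 - x) - 1)) (ζ x *
      (n * deriv Real.smoothTransition (n * (1 - x) - 1)) * Real.smoothTransition (n * x - 1))
  linarith

/-- The weak `x`-derivative may be tested with products `ζ(x) θ(t)` where `ζ` only vanishes at the
end points of `[0,1]`. -/
theorem HasWeakDerivX.integral_mul {T : ℝ} {φ g : ℝ → ℝ → ℝ}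
    (hg : HasWeakDerivX T φ g)
    (hφ : ContinuousOn (fun p : ℝ × ℝ => φ p.1 p.2) (Icc (0 : ℝ) 1 ×ˢ Icc (0 : ℝ) T))
    {ζ θ : ℝ → ℝ} (hζ : ContDiff ℝ 1 ζ) (h0 : ζ 0 = 0) (h1 : ζ 1 = 0) (hθ : ContDiff ℝ 1 θ) :
    ∫ p in cylinder T, φ p.1 p.2 * (deriv ζ p.1 * θ p.2)
      = -∫ p in cylinder T, g p.1 p.2 * (ζ p.1 * θ p.2) := by
  obtain ⟨B, hB⟩ := exists_bound_deriv_mul_cutoff hζ h0 h1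
  obtain ⟨K, hK⟩ := (isCompact_Icc (a := (0 : ℝ)) (b := 1)).exists_bound_of_continuousOn
    hζ.continuous.continuousOn
  obtain ⟨M, hM⟩ := (isCompact_Icc (a := (0 : ℝ)) (b := T)).exists_bound_of_continuousOn
    hθ.continuous.continuousOn
  -- Only `x`-derivatives are taken, so the cutoff in time needs no derivative bound and `θ` no end
  -- conditions.
  set η : ℕ → ℝ → ℝ → ℝ := fun n x t => (ζ x * cutoff 1 n x) * (θ t * cutoff T n t) with hη
  have hζn : ∀ n, ContDiff ℝ 1 fun x => ζ x * cutoff 1 n x := fun n =>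
    hζ.mul (contDiff_cutoff 1 n)
  have hθn : ∀ n, ContDiff ℝ 1 fun t => θ t * cutoff T n t := fun n =>
    hθ.mul (contDiff_cutoff T n)
  have hderiv : ∀ n x t, deriv (fun x => η n x t) x
      = deriv (fun x => ζ x * cutoff 1 n x) x * (θ t * cutoff T n t) := fun n x t =>
    deriv_mul_const ((hζn n).differentiable one_ne_zero x) _
  have heq : ∀ n : ℕ, 0 < n →
      ∫ p in cylinder T, φ p.1 p.2 * (deriv (fun x => ζ x * cutoff 1 n x) p.1
          * (θ p.2 * cutoff T n p.2))
        = -∫ p in cylinder T, g p.1 p.2 * η n p.1 p.2 := by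
    intro n hn
    have hn' : (0 : ℝ) < 1 / n := by positivity
    have hzero : ∀ p : ℝ × ℝ, p ∉ Icc (1 / (n : ℝ)) (1 - 1 / n) ×ˢ Icc (1 / (n : ℝ)) (T - 1 / n) →
        η n p.1 p.2 = 0 := by
      intro p hp
      rw [mem_prod, not_and_or] at hp
      rcases hp with h | h
      · simp only [hη, cutoff_eq_zero hn h, mul_zero, zero_mul]
      · simp only [hη, cutoff_eq_zero hn h, mul_zero]
    have hsub : tsupport (fun p : ℝ × ℝ => η n p.1 p.2)
        ⊆ Icc (1 / (n : ℝ)) (1 - 1 / n) ×ˢ Icc (1 / (n : ℝ)) (T - 1 / n) := by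
      refine closure_minimal (fun p hp => ?_) (isClosed_Icc.prod isClosed_Icc)
      by_contra h
      exact hp (hzero p h)
    have := hg.2 (η n)
      (((hζn n).comp contDiff_fst).mul ((hθn n).comp contDiff_snd))
      (HasCompactSupport.intro (isCompact_Icc.prod isCompact_Icc) hzero)
      (hsub.trans (prod_mono (Icc_subset_Ioo hn' (by linarith)) (Icc_subset_Ioo hn' (by linarith))))
    simp_rw [hderiv] at this
    exact this
  have hgint : Integrable (fun p : ℝ × ℝ => g p.1 p.2) (volume.restrict (cylinder T)) :=
    hg.1.integrable one_le_two
  have hφint := integrable_cylinder hφ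
  have hcont : ∀ n, Continuous fun p : ℝ × ℝ =>
      deriv (fun x => ζ x * cutoff 1 n x) p.1 * (θ p.2 * cutoff T n p.2) := fun n =>
    (((hζn n).continuous_deriv le_rfl).comp continuous_fst).mul
      ((hθn n).continuous.comp continuous_snd)
  have hcη : ∀ n, Continuous fun p : ℝ × ℝ => η n p.1 p.2 := fun n =>
    ((hζn n).continuous.comp continuous_fst).mul ((hθn n).continuous.comp continuous_snd)
  have hθb : ∀ n, ∀ t ∈ Icc 0 T, |θ t * cutoff T n t| ≤ M := by
    intro n t ht
    rw [abs_mul]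
    calc _ ≤ M * 1 := mul_le_mul (hM t ht) (abs_cutoff_le T n t) (abs_nonneg _)
          ((norm_nonneg _).trans (hM t ht))
      _ = M := mul_one M
  have hL : Filter.Tendsto (fun n : ℕ => ∫ p in cylinder T, φ p.1 p.2 *
      (deriv (fun x => ζ x * cutoff 1 n x) p.1 * (θ p.2 * cutoff T n p.2))) Filter.atTop
      (nhds (∫ p in cylinder T, φ p.1 p.2 * (deriv ζ p.1 * θ p.2))) := by
    refine tendsto_integral_of_dominated_convergence (fun p => |φ p.1 p.2| * (B * M))
      (fun n => hφint.aestronglyMeasurable.mul (hcont n).aestronglyMeasurable)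
      (hφint.abs.mul_const _) (fun n => ?_) ?_
    · filter_upwards [ae_restrict_mem (measurableSet_cylinder T)] with p hp
      have hp' := cylinder_subset T hp
      have hb := hB n p.1 hp'.1
      rw [norm_mul, norm_mul]
      exact mul_le_mul_of_nonneg_left (mul_le_mul hb (hθb n _ hp'.2) (norm_nonneg _)
        ((abs_nonneg _).trans hb)) (norm_nonneg _)
    · filter_upwards [ae_restrict_mem (measurableSet_cylinder T)] with p hp
      refine tendsto_const_nhds.congr' ?_
      filter_upwards [eventually_cutoff_eq_one hp.1, eventually_cutoff_eq_one hp.2] with n e1 e2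
      have : (fun x => ζ x * cutoff 1 n x) =ᶠ[nhds p.1] ζ := by
        filter_upwards [e1] with x hx
        rw [hx, mul_one]
      rw [this.deriv_eq, e2.eq_of_nhds, mul_one]
  have hR : Filter.Tendsto (fun n : ℕ => -∫ p in cylinder T, g p.1 p.2 * η n p.1 p.2) Filter.atTop
      (nhds (-∫ p in cylinder T, g p.1 p.2 * (ζ p.1 * θ p.2))) := by
    refine (tendsto_integral_of_dominated_convergence (fun p => |g p.1 p.2| * (K * M))
      (fun n => hgint.aestronglyMeasurable.fun_mul (hcη n).aestronglyMeasurable)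
      (hgint.abs.mul_const _) (fun n => ?_) ?_).neg
    · filter_upwards [ae_restrict_mem (measurableSet_cylinder T)] with p hp
      have hp' := cylinder_subset T hp
      have hb : |ζ p.1 * cutoff 1 n p.1| ≤ K := by
        rw [abs_mul]
        calc _ ≤ K * 1 := mul_le_mul (hK _ hp'.1) (abs_cutoff_le 1 n _) (abs_nonneg _)
              ((norm_nonneg _).trans (hK _ hp'.1))
          _ = K := mul_one K
      rw [norm_mul, norm_mul]
      exact mul_le_mul_of_nonneg_left (mul_le_mul hb (hθb n _ hp'.2) (norm_nonneg _)
        ((abs_nonneg _).trans hb)) (norm_nonneg _)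
    · filter_upwards [ae_restrict_mem (measurableSet_cylinder T)] with p hp
      refine tendsto_const_nhds.congr' ?_
      filter_upwards [eventually_cutoff_eq_one hp.1, eventually_cutoff_eq_one hp.2] with n e1 e2
      simp only [hη, e1.eq_of_nhds, e2.eq_of_nhds, mul_one]
  refine tendsto_nhds_unique (hL.congr' ?_) hR
  filter_upwards [Filter.eventually_gt_atTop 0] with n hn
  exact heq n hn

/-! ### The adjoint state: coefficient equations, decay and duality. -/

lemma IsAdjointState.congr {T α : ℝ} (hT : 0 ≤ T) {d : ℝ → ℝ} {φ ψ : ℝ → ℝ → ℝ}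
    (hφ : IsAdjointState T α d φ)
    (h : ∀ x ∈ Icc (0 : ℝ) 1, ∀ t ∈ Icc (0 : ℝ) T, φ x t = ψ x t) : IsAdjointState T α d ψ := by
  obtain ⟨g, ⟨hg, hgw⟩, hw⟩ := hφ.weak
  have hQ : ∀ f : ℝ × ℝ → ℝ, ∫ p in cylinder T, ψ p.1 p.2 * f p
      = ∫ p in cylinder T, φ p.1 p.2 * f p := fun f =>
    setIntegral_congr_fun (measurableSet_cylinder T) fun p hp => by
      have := cylinder_subset T hp
      simp only [h p.1 this.1 p.2 this.2]
  refine ⟨hφ.continuousOn.congr fun p hp => (h p.1 hp.1 p.2 hp.2).symm,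
    fun x hx => by rw [← h x hx T ⟨hT, le_rfl⟩, hφ.terminal x hx], g, ⟨hg, fun η h1 h2 h3 => ?_⟩,
    fun v hv => ?_⟩
  · rw [hQ]; exact hgw η h1 h2 h3
  · rw [← hw v hv, hQ]
    congr 2
    · congr 1
      refine intervalIntegral.integral_congr fun x hx => ?_
      rw [uIcc_of_le zero_le_one] at hx
      simp only [h x hx 0 ⟨le_rfl, hT⟩]
    · refine intervalIntegral.integral_congr fun t ht => ?_
      rw [uIcc_of_le hT] at ht
      simp only [h 1 (by norm_num) t ht]

lemma hasDerivAt_eigen_cos (k : ℕ) (x : ℝ) : HasDerivAt (fun x => Real.cos (k * Real.pi * x))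
    (-(k * Real.pi * Real.sin (k * Real.pi * x))) x := by
  have h1 : HasDerivAt (fun x : ℝ => k * Real.pi * x) (k * Real.pi) x := by
    simpa using (hasDerivAt_id x).const_mul (k * Real.pi)
  convert! h1.cos using 1; ring

lemma hasDerivAt_eigen_sin (k : ℕ) (x : ℝ) :
    HasDerivAt (fun x => k * Real.pi * Real.sin (k * Real.pi * x))
      ((k * Real.pi) ^ 2 * Real.cos (k * Real.pi * x)) x := by
  have h1 : HasDerivAt (fun x : ℝ => k * Real.pi * x) (k * Real.pi) x := by
    simpa using (hasDerivAt_id x).const_mul (k * Real.pi)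
  convert! h1.sin.const_mul (k * Real.pi) using 1; ring

section Adjoint

variable {T α D : ℝ} {d : ℝ → ℝ} {φ : ℝ → ℝ → ℝ}

/-- The right-hand side of the ordinary differential equation satisfied by the `k`-th cosine
coefficient of the adjoint state. -/
noncomputable def adjointRate (α : ℝ) (φ : ℝ → ℝ → ℝ) (k : ℕ) (t : ℝ) : ℝ :=
  (k * Real.pi) ^ 2 * cosCoeff (fun x => φ x t) k + α * Real.cos (k * Real.pi) * φ 1 t

lemma continuous_trace (hc : Continuous fun p : ℝ × ℝ => φ p.1 p.2) :
    Continuous fun t => φ 1 t :=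
  hc.comp (by fun_prop : Continuous fun t : ℝ => ((1 : ℝ), t))

lemma continuous_adjointRate (hc : Continuous fun p : ℝ × ℝ => φ p.1 p.2) (k : ℕ) :
    Continuous (adjointRate α φ k) := by
  have := continuous_cosCoeff hc k
  have := continuous_trace hc
  unfold adjointRate
  fun_prop

lemma integral_cylinder_mul_cos (hT : 0 ≤ T) (hc : Continuous fun p : ℝ × ℝ => φ p.1 p.2)
    (k : ℕ) {f : ℝ → ℝ} (hf : Continuous f) :
    ∫ p in cylinder T, φ p.1 p.2 * (Real.cos (k * Real.pi * p.1) * f p.2)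
      = ∫ t in (0 : ℝ)..T, cosCoeff (fun x => φ x t) k * f t := by
  rw [integral_cylinder hT (integrable_cylinder (Continuous.continuousOn (by fun_prop)))]
  congr 1; ext t
  rw [cosCoeff, ← intervalIntegral.integral_mul_const]
  congr 1; ext x; ring

/-- The adjoint equation tested with `cos(kπx) θ(t)`. -/
lemma IsAdjointState.cosCoeff_weak (hT : 0 ≤ T) (hφ : IsAdjointState T α d φ)
    (hc : Continuous fun p : ℝ × ℝ => φ p.1 p.2) (k : ℕ) {θ : ℝ → ℝ} (hθ : ContDiff ℝ 1 θ) :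
    cosCoeff (fun x => φ x 0) k * θ 0
        + (∫ t in (0 : ℝ)..T, cosCoeff (fun x => φ x t) k * deriv θ t)
        + ∫ t in (0 : ℝ)..T, adjointRate α φ k t * θ t
      = cosCoeff d k * θ T := by
  obtain ⟨g, hg, hw⟩ := hφ.weak
  have hv : ContDiff ℝ 1 fun p : ℝ × ℝ => Real.cos (k * Real.pi * p.1) * θ p.2 := by fun_prop
  have h := hw (fun x t => Real.cos (k * Real.pi * x) * θ t) hv
  have hθd := hθ.continuous_deriv le_rfl
  have hθc := hθ.continuous
  have e1 : ∀ f : ℝ → ℝ, ∀ c : ℝ, ∫ x in (0 : ℝ)..1, f x * (Real.cos (k * Real.pi * x) * c)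
      = cosCoeff f k * c := by
    intro f c
    rw [cosCoeff, ← intervalIntegral.integral_mul_const]
    congr 1; ext x; ring
  have e2 : ∀ x t : ℝ, deriv (fun t => Real.cos (k * Real.pi * x) * θ t) t
      = Real.cos (k * Real.pi * x) * deriv θ t := fun x t =>
    deriv_const_mul _ (hθ.differentiable one_ne_zero t)
  have e3 : ∀ x t : ℝ, deriv (fun x => Real.cos (k * Real.pi * x) * θ t) x
      = -(k * Real.pi * Real.sin (k * Real.pi * x) * θ t) := by
    intro x t
    rw [((hasDerivAt_eigen_cos k x).mul_const (θ t)).deriv]; ring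
  -- The `x`-derivative of the test function is a multiple of `sin(kπx)`, zero at both ends. Moving
  -- the weak derivative back onto `φ` thus yields the eigenvalue and no boundary term.
  have hs := hg.integral_mul hφ.continuousOn
    (ζ := fun x => k * Real.pi * Real.sin (k * Real.pi * x)) (by fun_prop) (by simp)
    (by simp [Real.sin_nat_mul_pi]) hθ
  have e4 : ∀ x : ℝ, deriv (fun x => k * Real.pi * Real.sin (k * Real.pi * x)) x
      = (k * Real.pi) ^ 2 * Real.cos (k * Real.pi * x) := fun x => (hasDerivAt_eigen_sin k x).deriv
  simp_rw [e4] at hs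
  have e5 : ∫ p in cylinder T, φ p.1 p.2 *
      ((k * Real.pi) ^ 2 * Real.cos (k * Real.pi * p.1) * θ p.2)
      = (k * Real.pi) ^ 2 * ∫ t in (0 : ℝ)..T, cosCoeff (fun x => φ x t) k * θ t := by
    rw [← integral_cylinder_mul_cos hT hc k hθc, ← integral_const_mul]
    congr 1; ext p; ring
  rw [e5] at hs
  simp_rw [e2, e3] at h
  rw [e1, e1, integral_cylinder_mul_cos hT hc k hθd] at h
  simp_rw [mul_neg, integral_neg] at h
  rw [← hs] at h
  have hcc := continuous_cosCoeff hc k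
  have htr := continuous_trace hc
  have e6 : ∫ t in (0 : ℝ)..T, adjointRate α φ k t * θ t
      = (k * Real.pi) ^ 2 * (∫ t in (0 : ℝ)..T, cosCoeff (fun x => φ x t) k * θ t)
        + α * ∫ t in (0 : ℝ)..T, φ 1 t * (Real.cos (k * Real.pi * 1) * θ t) := by
    have c1 : Continuous fun t => (k * Real.pi) ^ 2 * (cosCoeff (fun x => φ x t) k * θ t) := by
      fun_prop
    have c2 : Continuous fun t => α * (φ 1 t * (Real.cos (k * Real.pi * 1) * θ t)) := by
      fun_prop
    rw [← intervalIntegral.integral_const_mul, ← intervalIntegral.integral_const_mul,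
      ← intervalIntegral.integral_add (c1.intervalIntegrable _ _) (c2.intervalIntegrable _ _)]
    congr 1; ext t; simp only [adjointRate, mul_one]; ring
  rw [e6, ← h]; ring

/-- The cosine coefficients of the adjoint state solve their ordinary differential equation. -/
lemma IsAdjointState.cosCoeff_eq (hT : 0 < T) (hφ : IsAdjointState T α d φ)
    (hc : Continuous fun p : ℝ × ℝ => φ p.1 p.2) (k : ℕ) {t : ℝ} (ht : t ∈ Icc 0 T) :
    cosCoeff (fun x => φ x t) k = cosCoeff d k + ∫ s in T..t, adjointRate α φ k s := by
  have hR := continuous_adjointRate (α := α) hc k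
  set I : ℝ → ℝ := fun t => ∫ s in T..t, adjointRate α φ k s with hI
  have hId : ∀ t, HasDerivAt I (adjointRate α φ k t) t := fun t =>
    hR.integral_hasStrictDerivAt T t |>.hasDerivAt
  have hIc : Continuous I := continuous_iff_continuousAt.2 fun t => (hId t).continuousAt
  have hcc := continuous_cosCoeff hc k
  -- `F` is the defect in the claimed identity. Testing with its own primitive `θ` turns the weak
  -- equation into `∫ F² = 0`.
  set F : ℝ → ℝ := fun t => cosCoeff (fun x => φ x t) k - I t - cosCoeff d k with hF
  have hFc : Continuous F := by fun_prop
  set θ : ℝ → ℝ := fun t => ∫ s in (0 : ℝ)..t, F s with hθ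
  have hθd : ∀ t, HasDerivAt θ (F t) t := fun t =>
    hFc.integral_hasStrictDerivAt 0 t |>.hasDerivAt
  have hderiv : deriv θ = F := funext fun t => (hθd t).deriv
  have hθ1 : ContDiff ℝ 1 θ := contDiff_one_iff_deriv.2
    ⟨fun t => (hθd t).differentiableAt, by rw [hderiv]; exact hFc⟩
  have hw := hφ.cosCoeff_weak hT.le hc k hθ1
  have hparts := intervalIntegral.integral_deriv_mul_eq_sub (a := 0) (b := T)
    (fun t _ => hId t) (fun t _ => hθd t) (hR.intervalIntegrable _ _) (hFc.intervalIntegrable _ _)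
  have hθ0 : θ 0 = 0 := by simp [hθ]
  have hIT : I T = 0 := by simp [hI]
  have c1 : Continuous fun t => adjointRate α φ k t * θ t := hR.fun_mul hθ1.continuous
  have c2 : Continuous fun t => I t * F t := hIc.fun_mul hFc
  have c3 : Continuous fun t => cosCoeff (fun x => φ x t) k * F t := hcc.fun_mul hFc
  rw [intervalIntegral.integral_add (c1.intervalIntegrable _ _) (c2.intervalIntegrable _ _),
    hθ0, hIT] at hparts
  rw [hderiv, hθ0] at hw
  have hzero : ∫ t in (0 : ℝ)..T, F t * F t = 0 := by
    have c4 : Continuous fun t => cosCoeff d k * F t := by fun_prop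
    have c5 : Continuous fun t => cosCoeff (fun x => φ x t) k * F t - I t * F t := c3.sub c2
    have hsplit : ∫ t in (0 : ℝ)..T, F t * F t
        = (∫ t in (0 : ℝ)..T, cosCoeff (fun x => φ x t) k * F t)
          - (∫ t in (0 : ℝ)..T, I t * F t) - cosCoeff d k * ∫ t in (0 : ℝ)..T, F t := by
      rw [← intervalIntegral.integral_const_mul,
        ← intervalIntegral.integral_sub (c3.intervalIntegrable _ _) (c2.intervalIntegrable _ _),
        ← intervalIntegral.integral_sub (c5.intervalIntegrable _ _) (c4.intervalIntegrable _ _)]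
      congr 1; ext t; simp only [hF]; ring
    have hθT : θ T = ∫ t in (0 : ℝ)..T, F t := rfl
    rw [hsplit, ← hθT]
    linarith
  have hFt : F t = 0 := by
    by_contra hne
    have := intervalIntegral.integral_pos hT (hFc.fun_mul hFc).continuousOn
      (fun s _ => mul_self_nonneg (F s)) ⟨t, ht, mul_self_pos.2 hne⟩
    exact this.ne' hzero
  simp only [hF] at hFt
  linarith

lemma abs_cosCoeff_le {f : ℝ → ℝ} (hf : ∀ x ∈ Icc (0 : ℝ) 1, |f x| ≤ D) (k : ℕ) :
    |cosCoeff f k| ≤ D := by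
  have := intervalIntegral.norm_integral_le_of_norm_le_const (a := 0) (b := 1) (C := D)
    (f := fun x => Real.cos (k * Real.pi * x) * f x) (fun x hx => ?_)
  · simpa [cosCoeff] using this
  · rw [uIoc_of_le zero_le_one] at hx
    rw [norm_mul]
    have h := hf x (Ioc_subset_Icc_self hx)
    calc _ ≤ 1 * D := mul_le_mul (Real.abs_cos_le_one _) h (abs_nonneg _) zero_le_one
      _ = D := one_mul D

lemma integral_exp_shift_le {m t T : ℝ} (hm : 0 < m) :
    ∫ s in t..T, Real.exp (-m * (s - t)) ≤ 1 / m := by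
  have h := intervalIntegral.integral_comp_sub_right (a := t) (b := T)
    (fun s => Real.exp (-m * s)) t
  have h2 := intervalIntegral.integral_comp_sub_left (a := 0) (b := T - t)
    (fun s => Real.exp (-m * s)) (T - t)
  simp only [sub_self, sub_zero] at h h2
  rw [h, ← h2]
  exact integral_exp_decay_le hm

/-- Rate `m` is exchanged for `m + 1` at the cost of `exp T`, so that `k = 0` needs no separate
treatment. -/
lemma exp_eigenvalue_le {m s T : ℝ} (hs : s ≤ T) :
    Real.exp (-m * s) ≤ Real.exp T * Real.exp (-(m + 1) * s) := by
  rw [← Real.exp_add]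
  exact Real.exp_le_exp.2 (by linarith)

/-- Decay of the cosine coefficients of the adjoint state. -/
lemma IsAdjointState.abs_cosCoeff_le (hT : 0 < T) (hα : 0 ≤ α) (hφ : IsAdjointState T α d φ)
    (hc : Continuous fun p : ℝ × ℝ => φ p.1 p.2) (hD : ∀ x t, |φ x t| ≤ D) (k : ℕ) {t : ℝ}
    (ht : t ∈ Icc 0 T) :
    |cosCoeff (fun x => φ x t) k| ≤ Real.exp T *
      (D * Real.exp (-((k * Real.pi) ^ 2 + 1) * (T - t)) + α * D / ((k * Real.pi) ^ 2 + 1)) := by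
  set m : ℝ := (k * Real.pi) ^ 2 with hm
  have hm0 : 0 ≤ m := by positivity
  have hD0 : 0 ≤ D := (abs_nonneg _).trans (hD 0 0)
  set c := Real.cos (k * Real.pi) with hcdef
  have hR := continuous_adjointRate (α := α) hc k
  -- `Ψ` is differentiable on the whole line and equals the coefficient on `[0,T]`. There `Ψ' = m Ψ
  -- + α c φ(1,·)`, which is solved backwards from `T` with the integrating factor `exp(-m(s-t))`.
  set Ψ : ℝ → ℝ := fun t => cosCoeff d k + ∫ s in T..t, adjointRate α φ k s with hΨ
  have hΨd : ∀ t, HasDerivAt Ψ (adjointRate α φ k t) t := fun t =>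
    (hR.integral_hasStrictDerivAt T t).hasDerivAt.const_add _
  have hΨc : Continuous Ψ := continuous_iff_continuousAt.2 fun t => (hΨd t).continuousAt
  have hΨeq : ∀ s ∈ Icc 0 T, Ψ s = cosCoeff (fun x => φ x s) k := fun s hs =>
    (hφ.cosCoeff_eq hT hc k hs).symm
  have htr := continuous_trace hc
  have hder : ∀ s, HasDerivAt (fun s => Real.exp (-m * (s - t)) * Ψ s)
      (Real.exp (-m * (s - t)) * (adjointRate α φ k s - m * Ψ s)) s := by
    intro s
    have h : HasDerivAt (fun s => -m * (s - t)) (-m) s := by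
      simpa using ((hasDerivAt_id s).sub_const t).const_mul (-m)
    convert! h.exp.mul (hΨd s) using 1; ring
  have hint := intervalIntegral.integral_eq_sub_of_hasDerivAt (a := t) (b := T)
    (fun s _ => hder s) (Continuous.intervalIntegrable (by fun_prop) _ _)
  have hint2 : ∫ s in t..T, Real.exp (-m * (s - t)) * (adjointRate α φ k s - m * Ψ s)
      = ∫ s in t..T, Real.exp (-m * (s - t)) * (α * c * φ 1 s) := by
    refine intervalIntegral.integral_congr fun s hs => ?_
    rw [uIcc_of_le ht.2] at hs
    have := hΨeq s ⟨ht.1.trans hs.1, hs.2⟩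
    simp only [this, adjointRate]; ring
  rw [hint2, sub_self, mul_zero, Real.exp_zero, one_mul, hΨeq t ht,
    hΨeq T ⟨hT.le, le_rfl⟩] at hint
  have hc1 : |c| ≤ 1 := Real.abs_cos_le_one _
  have b1 : |∫ s in t..T, Real.exp (-m * (s - t)) * (α * c * φ 1 s)|
      ≤ Real.exp T * (α * D / (m + 1)) := by
    have hci : IntervalIntegrable
        (fun s => Real.exp (-(m + 1) * (s - t)) * (Real.exp T * (α * D))) volume t T :=
      Continuous.intervalIntegrable (by fun_prop) _ _
    calc |∫ s in t..T, Real.exp (-m * (s - t)) * (α * c * φ 1 s)|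
        ≤ ∫ s in t..T, Real.exp (-(m + 1) * (s - t)) * (Real.exp T * (α * D)) := by
          rw [← Real.norm_eq_abs]
          refine intervalIntegral.norm_integral_le_of_norm_le ht.2 ?_ hci
          refine ae_of_all _ fun s hs => ?_
          rw [Real.norm_eq_abs, abs_mul, abs_mul, abs_mul, abs_of_pos (Real.exp_pos _),
            abs_of_nonneg hα]
          have h1 := exp_eigenvalue_le (m := m) (s := s - t) (T := T) (by linarith [hs.2, ht.1])
          calc Real.exp (-m * (s - t)) * (α * |c| * |φ 1 s|)
              ≤ Real.exp T * Real.exp (-(m + 1) * (s - t)) * (α * 1 * D) := by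
                gcongr
                exact hD 1 s
            _ = _ := by ring
      _ = (∫ s in t..T, Real.exp (-(m + 1) * (s - t))) * (Real.exp T * (α * D)) := by
          rw [intervalIntegral.integral_mul_const]
      _ ≤ 1 / (m + 1) * (Real.exp T * (α * D)) :=
          mul_le_mul_of_nonneg_right (integral_exp_shift_le (by linarith)) (by positivity)
      _ = _ := by ring
  have b2 : |Real.exp (-m * (T - t)) * cosCoeff (fun x => φ x T) k|
      ≤ Real.exp T * Real.exp (-(m + 1) * (T - t)) * D := by
    rw [abs_mul, abs_of_pos (Real.exp_pos _)]
    have h1 := exp_eigenvalue_le (m := m) (s := T - t) (T := T) (by linarith [ht.1])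
    have h2 := SparseHeatControl.abs_cosCoeff_le (fun x _ => hD x T) k
    gcongr
  have e : cosCoeff (fun x => φ x t) k = Real.exp (-m * (T - t)) * cosCoeff (fun x => φ x T) k
      - ∫ s in t..T, Real.exp (-m * (s - t)) * (α * c * φ 1 s) := by linarith
  rw [e]
  refine (abs_sub _ _).trans ((add_le_add b2 b1).trans (le_of_eq ?_))
  ring

/-- Before the final time the heat flow has smoothed the datum: `exp(-m(T-t)) ≤ 1/(m(T-t))`. At `t =
T` this fails, as `d` need not have summable coefficients. -/
lemma IsAdjointState.summable_cosCoeff (hT : 0 < T) (hα : 0 ≤ α) (hφ : IsAdjointState T α d φ)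
    (hc : Continuous fun p : ℝ × ℝ => φ p.1 p.2) (hD : ∀ x t, |φ x t| ≤ D) {t : ℝ}
    (ht : t ∈ Ico 0 T) : Summable (cosCoeff fun x => φ x t) := by
  have hD0 : 0 ≤ D := (abs_nonneg _).trans (hD 0 0)
  have htT : 0 < T - t := sub_pos.2 ht.2
  refine Summable.of_norm_bounded (((summable_const_div_eigenvalue (D / (T - t))).add
    (summable_const_div_eigenvalue (α * D))).mul_left (Real.exp T)) fun k => ?_
  refine (hφ.abs_cosCoeff_le hT hα hc hD k ⟨ht.1, ht.2.le⟩).trans ?_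
  refine mul_le_mul_of_nonneg_left (add_le_add ?_ le_rfl) (Real.exp_pos _).le
  set m : ℝ := (k * Real.pi) ^ 2 + 1
  have hm : 0 < m := by positivity
  have : Real.exp (-m * (T - t)) ≤ 1 / (m * (T - t)) := by
    rw [neg_mul, Real.exp_neg, ← one_div]
    refine one_div_le_one_div_of_le (by positivity) ?_
    linarith [Real.add_one_le_exp (m * (T - t))]
  calc D * Real.exp (-m * (T - t)) ≤ D * (1 / (m * (T - t))) := by gcongr
    _ = D / (T - t) / m := by field_simp

/-- Integrating the exponential in time gains `1/m` directly and so avoids the factor `1/(T-t)` of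
the pointwise estimate. This justifies exchanging sum and time integral. -/
lemma IsAdjointState.integral_abs_cosCoeff_le (hT : 0 < T) (hα : 0 ≤ α)
    (hφ : IsAdjointState T α d φ) (hc : Continuous fun p : ℝ × ℝ => φ p.1 p.2)
    (hD : ∀ x t, |φ x t| ≤ D) (k : ℕ) :
    ∫ t in (0 : ℝ)..T, |cosCoeff (fun x => φ x t) k|
      ≤ Real.exp T * (D + T * (α * D)) / ((k * Real.pi) ^ 2 + 1) := by
  have hD0 : 0 ≤ D := (abs_nonneg _).trans (hD 0 0)
  set m : ℝ := (k * Real.pi) ^ 2 + 1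
  have hm : 0 < m := by positivity
  have hcc := continuous_cosCoeff hc k
  have c1 : Continuous fun t => D * Real.exp (-m * (T - t)) := by fun_prop
  calc ∫ t in (0 : ℝ)..T, |cosCoeff (fun x => φ x t) k|
      ≤ ∫ t in (0 : ℝ)..T, Real.exp T * (D * Real.exp (-m * (T - t)) + α * D / m) := by
        refine intervalIntegral.integral_mono_on hT.le (hcc.abs.intervalIntegrable _ _)
          (Continuous.intervalIntegrable (by fun_prop) _ _) fun t ht => ?_
        exact hφ.abs_cosCoeff_le hT hα hc hD k ht
    _ = Real.exp T * (D * (∫ t in (0 : ℝ)..T, Real.exp (-m * (T - t))) + T * (α * D / m)) := by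
        rw [intervalIntegral.integral_const_mul,
          intervalIntegral.integral_add (c1.intervalIntegrable _ _) intervalIntegrable_const,
          intervalIntegral.integral_const_mul, intervalIntegral.integral_const, sub_zero,
          smul_eq_mul]
    _ ≤ Real.exp T * (D * (1 / m) + T * (α * D / m)) := by
        have := integral_exp_decay_le (m := m) (t := T) hm
        gcongr
    _ = _ := by ring

/-- Duality between the state and the adjoint state, for globally continuous bounded adjoints. -/
theorem IsAdjointState.duality_of_continuous (hT : 0 < T) (hα : 0 ≤ α)
    (hφ : IsAdjointState T α d φ) (hd : ContinuousOn d (Icc 0 1))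
    (hc : Continuous fun p : ℝ × ℝ => φ p.1 p.2) (hD : ∀ x t, |φ x t| ≤ D) {q : ℝ → ℝ}
    (hq : Measurable q) {C : ℝ} (hC : ∀ t, |q t| ≤ C) :
    ∫ x in (0 : ℝ)..1, neumannState q x T * d x
      = α * (∫ t in (0 : ℝ)..T, φ 1 t * neumannState q 1 t) + ∫ t in (0 : ℝ)..T, φ 1 t * q t := by
  have hqi := intervalIntegrable_of_bounded hq hC
  have hD0 : 0 ≤ D := (abs_nonneg _).trans (hD 0 0)
  have hC0 : 0 ≤ C := (abs_nonneg _).trans (hC 0)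
  have htr := continuous_trace hc
  have s1 := hasSum_integral_neumannState_slice (t := T) hC hT.le hd
  have s2 : HasSum (fun k => ∫ t in (0 : ℝ)..T, cosWeight k * (φ 1 t * mode q k t))
      (∫ t in (0 : ℝ)..T, φ 1 t * neumannState q 1 t) := by
    refine intervalIntegral.hasSum_integral_of_dominated_convergence
      (fun k _ => D * (2 * (Real.exp T * C) / ((k * Real.pi) ^ 2 + 1)))
      (fun k => ?_) (fun k => ae_of_all _ fun t ht => ?_)
      (ae_of_all _ fun t _ => (summable_const_div_eigenvalue _).mul_left _)
      intervalIntegrable_const (ae_of_all _ fun t ht => ?_)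
    · have := continuous_mode hq hC k
      exact Continuous.aestronglyMeasurable (by fun_prop)
    · rw [uIoc_of_le hT.le] at ht
      have h1 := abs_neumannTerm_le hC (Ioc_subset_Icc_self ht) k 1
      rw [mul_one, ← mul_assoc, endWeight_mul_cos] at h1
      rw [mul_left_comm, norm_mul]
      exact mul_le_mul (hD 1 t) h1 (norm_nonneg _) hD0
    · rw [uIoc_of_le hT.le] at ht
      have h1 := (summable_neumannTerm hC ht.1.le 1).hasSum.mul_left (φ 1 t)
      convert! h1 using 1
      ext k
      rw [mul_one, ← mul_assoc (endWeight k), endWeight_mul_cos]; ring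
  have s3 : HasSum (fun k => ∫ t in (0 : ℝ)..T, endWeight k * (cosCoeff (fun x => φ x t) k * q t))
      (∫ t in (0 : ℝ)..T, φ 1 t * q t) := by
    have hintk : ∀ k, IntervalIntegrable
        (fun t => endWeight k * (cosCoeff (fun x => φ x t) k * q t)) volume 0 T := fun k =>
      ((hqi 0 T).continuousOn_mul (continuous_cosCoeff hc k).continuousOn).const_mul _
    have h := hasSum_integral_of_summable_integral_norm (μ := volume.restrict (Ioc 0 T))
      (F := fun k t => endWeight k * (cosCoeff (fun x => φ x t) k * q t))
      (fun k => (intervalIntegrable_iff_integrableOn_Ioc_of_le hT.le).1 (hintk k)) ?_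
    · simp_rw [intervalIntegral.integral_of_le hT.le]
      convert! h using 1
      -- The end time is discarded because the series for `φ(1,t)` is only available for `t < T`.
      rw [integral_Ioc_eq_integral_Ioo, integral_Ioc_eq_integral_Ioo]
      refine setIntegral_congr_fun measurableSet_Ioo fun t ht => ?_
      have hsl : ContinuousOn (fun x => φ x t) (Icc 0 1) :=
        (hc.comp (by fun_prop : Continuous fun x : ℝ => (x, t))).continuousOn
      have := (hasSum_cosCoeff hsl (hφ.summable_cosCoeff hT hα hc hD ⟨ht.1.le, ht.2⟩)).mul_right
        (q t)
      rw [← this.tsum_eq]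
      congr 1; ext k; ring
    · refine Summable.of_nonneg_of_le (fun k => integral_nonneg fun t => norm_nonneg _)
        (fun k => ?_) ((summable_const_div_eigenvalue
          (Real.exp T * (D + T * (α * D)))).mul_left (2 * C))
      have hcc := continuous_cosCoeff hc k
      rw [← intervalIntegral.integral_of_le hT.le]
      calc ∫ t in (0 : ℝ)..T, ‖endWeight k * (cosCoeff (fun x => φ x t) k * q t)‖
          ≤ ∫ t in (0 : ℝ)..T, 2 * C * |cosCoeff (fun x => φ x t) k| := by
            refine intervalIntegral.integral_mono_on hT.le (hintk k).norm
              (Continuous.intervalIntegrable (by fun_prop) _ _) fun t ht => ?_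
            rw [norm_mul, norm_mul]
            have h1 := abs_endWeight_le k
            have h2 := hC t
            simp only [Real.norm_eq_abs]
            calc |endWeight k| * (|cosCoeff (fun x => φ x t) k| * |q t|)
                ≤ 2 * (|cosCoeff (fun x => φ x t) k| * C) := by gcongr
              _ = _ := by ring
        _ = 2 * C * ∫ t in (0 : ℝ)..T, |cosCoeff (fun x => φ x t) k| :=
            intervalIntegral.integral_const_mul _ _
        _ ≤ _ := mul_le_mul_of_nonneg_left (hφ.integral_abs_cosCoeff_le hT hα hc hD k)
            (by positivity)
  refine s1.unique ?_
  convert! (s2.mul_left α).add s3 using 1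
  ext k
  have hR := continuous_adjointRate (α := α) hc k
  -- State and adjoint coefficients have the same eigenvalue and opposite time directions. In the
  -- product the eigenvalue terms cancel; only the boundary term with `α` and the flux `q` remain.
  have hparts := mul_duhamel_eq hqi ((k * Real.pi) ^ 2) T
    (F := fun t => cosCoeff d k + ∫ s in T..t, adjointRate α φ k s) (F' := adjointRate α φ k)
    (fun t => (hR.integral_hasStrictDerivAt T t).hasDerivAt.const_add _) hR
  simp only [intervalIntegral.integral_same, add_zero] at hparts
  have e1 : ∫ t in (0 : ℝ)..T, (adjointRate α φ k t - (k * Real.pi) ^ 2 *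
        (cosCoeff d k + ∫ s in T..t, adjointRate α φ k s)) * duhamel ((k * Real.pi) ^ 2) q t
      = ∫ t in (0 : ℝ)..T, α * Real.cos (k * Real.pi) * (φ 1 t * mode q k t) := by
    refine intervalIntegral.integral_congr fun t ht => ?_
    rw [uIcc_of_le hT.le] at ht
    rw [← hφ.cosCoeff_eq hT hc k ht]
    simp only [adjointRate, mode]; ring
  have e2 : ∫ t in (0 : ℝ)..T, (cosCoeff d k + ∫ s in T..t, adjointRate α φ k s) * q t
      = ∫ t in (0 : ℝ)..T, cosCoeff (fun x => φ x t) k * q t := by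
    refine intervalIntegral.integral_congr fun t ht => ?_
    rw [uIcc_of_le hT.le] at ht
    simp only [← hφ.cosCoeff_eq hT hc k ht]
  rw [e1, e2, intervalIntegral.integral_const_mul] at hparts
  rw [mode, hparts, intervalIntegral.integral_const_mul, intervalIntegral.integral_const_mul,
    ← endWeight_mul_cos]
  ring

end Adjoint

/-- Duality: the derivative of the tracking term in direction `h` is `∫ φ(1,t) h(t) dt`. -/
theorem IsAdjointState.exists_state_duality {T α : ℝ} (hT : 0 < T) (hα : 0 ≤ α) {d : ℝ → ℝ}
    {φ : ℝ → ℝ → ℝ} (hφ : IsAdjointState T α d φ) (hd : ContinuousOn d (Icc 0 1)) {h : ℝ → ℝ}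
    (hh : Measurable h) {M : ℝ} (hM : ∀ t, |h t| ≤ M) :
    ∃ z : ℝ → ℝ → ℝ, IsState T α h z ∧
      ∫ x in (0 : ℝ)..1, d x * z x T = ∫ t in (0 : ℝ)..T, φ 1 t * h t := by
  obtain ⟨q, hq, ⟨C, hC⟩, hqz⟩ := exists_neumann_flux hh hM hα T
  have hz := isState_neumannState hT.le hq hC
  refine ⟨neumannState q, hz.robin hT.le (intervalIntegrable_of_bounded hh hM _ _) hqz, ?_⟩
  obtain ⟨D, hD⟩ := (isCompact_Icc.prod isCompact_Icc :
    IsCompact (Icc (0 : ℝ) 1 ×ˢ Icc (0 : ℝ) T)).exists_bound_of_continuousOn hφ.continuousOn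
  -- `φ` is controlled only on the closed cylinder; clamping both variables extends it to a bounded
  -- continuous function on the plane.
  set ψ : ℝ → ℝ → ℝ := fun x t => φ (max 0 (min 1 x)) (max 0 (min T t)) with hψ
  have hmem : ∀ x t : ℝ, (max 0 (min 1 x), max 0 (min T t)) ∈ Icc (0 : ℝ) 1 ×ˢ Icc (0 : ℝ) T :=
    fun x t => ⟨⟨le_max_left _ _, max_le zero_le_one (min_le_left _ _)⟩,
      ⟨le_max_left _ _, max_le hT.le (min_le_left _ _)⟩⟩
  have hψeq : ∀ x ∈ Icc (0 : ℝ) 1, ∀ t ∈ Icc (0 : ℝ) T, φ x t = ψ x t := by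
    intro x hx t ht
    simp only [hψ, min_eq_right hx.2, max_eq_right hx.1, min_eq_right ht.2, max_eq_right ht.1]
  have hcl : Continuous fun p : ℝ × ℝ => (max 0 (min 1 p.1), max 0 (min T p.2)) := by fun_prop
  have hψc : Continuous fun p : ℝ × ℝ => ψ p.1 p.2 :=
    ContinuousOn.comp_continuous (f := fun p : ℝ × ℝ => (max 0 (min 1 p.1), max 0 (min T p.2)))
      hφ.continuousOn hcl fun p => hmem p.1 p.2
  have key := (hφ.congr hT.le hψeq).duality_of_continuous hT hα hd hψc
    (fun x t => hD _ (hmem x t)) hq hC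
  have hzc : ContinuousOn (fun t => ψ 1 t * neumannState q 1 t) (uIcc 0 T) := by
    rw [uIcc_of_le hT.le]
    refine (continuous_trace hψc).continuousOn.fun_mul ?_
    exact continuousOn_trace hz.continuousOn
  simp_rw [mul_comm (d _)]
  rw [key, ← intervalIntegral.integral_const_mul, ← intervalIntegral.integral_add
    (hzc.intervalIntegrable.const_mul α) ((intervalIntegrable_of_bounded hq hC 0 T).continuousOn_mul
      (continuous_trace hψc).continuousOn)]
  -- The two boundary terms recombine since `q + α z(1,·) = h` on `[0,T]`.
  refine intervalIntegral.integral_congr fun t ht => ?_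
  rw [uIcc_of_le hT.le] at ht
  simp only [hqz t ht, hψeq 1 (by norm_num) t ht]; ring

/-! ### Linearity of the state equation and expansion of the quadratic terms. -/

lemma HasWeakDerivX.add_const_mul {T : ℝ} {y z g k : ℝ → ℝ → ℝ}
    (hy : ContinuousOn (fun p : ℝ × ℝ => y p.1 p.2) (Icc (0 : ℝ) 1 ×ˢ Icc (0 : ℝ) T))
    (hz : ContinuousOn (fun p : ℝ × ℝ => z p.1 p.2) (Icc (0 : ℝ) 1 ×ˢ Icc (0 : ℝ) T))
    (hg : HasWeakDerivX T y g) (hk : HasWeakDerivX T z k) (s : ℝ) :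
    HasWeakDerivX T (fun x t => y x t + s * z x t) (fun x t => g x t + s * k x t) := by
  refine ⟨hg.1.add (hk.1.const_mul s), fun η h1 h2 h3 => ?_⟩
  have hη := memLp_cylinder (T := T) h1.continuous.continuousOn 2
  have hηd := (continuous_deriv_fst h1).continuousOn
    (s := Icc (0 : ℝ) 1 ×ˢ Icc (0 : ℝ) T)
  have e1 := hg.2 η h1 h2 h3
  have e2 := hk.2 η h1 h2 h3
  have i1 : Integrable (fun p : ℝ × ℝ => g p.1 p.2 * η p.1 p.2) (volume.restrict (cylinder T)) :=
    hg.1.integrable_mul hη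
  have i2 : Integrable (fun p : ℝ × ℝ => k p.1 p.2 * η p.1 p.2) (volume.restrict (cylinder T)) :=
    hk.1.integrable_mul hη
  simp_rw [add_mul, mul_assoc]
  rw [integral_add (integrable_cylinder (hy.fun_mul hηd))
    ((integrable_cylinder (hz.fun_mul hηd)).const_mul s), integral_add i1 (i2.const_mul s),
    integral_const_mul, integral_const_mul, e1, e2]
  ring

lemma IsState.add_const_mul {T α : ℝ} (hT : 0 ≤ T) {u h : ℝ → ℝ} {y z : ℝ → ℝ → ℝ}
    (hy : IsState T α u y) (hz : IsState T α h z) (hu : IntervalIntegrable u volume 0 T)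
    (hh : IntervalIntegrable h volume 0 T) (s : ℝ) :
    IsState T α (fun t => u t + s * h t) (fun x t => y x t + s * z x t) := by
  obtain ⟨g, hg, hgw⟩ := hy.weak
  obtain ⟨k, hk, hkw⟩ := hz.weak
  refine ⟨hy.continuousOn.add (hz.continuousOn.const_mul s), fun x hx => by
    rw [hy.initial x hx, hz.initial x hx]; ring, _,
    hg.add_const_mul hy.continuousOn hz.continuousOn hk s, fun v hv => ?_⟩
  have hvT : Continuous fun x => v x T :=
    hv.continuous.comp (by fun_prop : Continuous fun x : ℝ => (x, T))
  have hv1 := continuous_trace hv.continuous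
  have hvx := memLp_cylinder (T := T) (continuous_deriv_fst hv).continuousOn 2
  have hvt := (continuous_deriv_snd hv).continuousOn (s := Icc (0 : ℝ) 1 ×ˢ Icc (0 : ℝ) T)
  have hf : ∀ {w : ℝ → ℝ → ℝ}, ContinuousOn (fun p : ℝ × ℝ => w p.1 p.2)
      (Icc (0 : ℝ) 1 ×ˢ Icc (0 : ℝ) T) →
      IntervalIntegrable (fun x => w x T * v x T) volume 0 1 := fun hw =>
    ContinuousOn.intervalIntegrable_of_Icc zero_le_one
      ((continuousOn_final hT hw).fun_mul hvT.continuousOn)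
  have ht : ∀ {w : ℝ → ℝ → ℝ}, ContinuousOn (fun p : ℝ × ℝ => w p.1 p.2)
      (Icc (0 : ℝ) 1 ×ˢ Icc (0 : ℝ) T) →
      IntervalIntegrable (fun t => w 1 t * v 1 t) volume 0 T := fun hw =>
    ContinuousOn.intervalIntegrable_of_Icc hT ((continuousOn_trace hw).fun_mul hv1.continuousOn)
  have e1 := hgw v hv
  have e2 := hkw v hv
  have i1 : Integrable (fun p : ℝ × ℝ => g p.1 p.2 * deriv (fun x => v x p.2) p.1)
      (volume.restrict (cylinder T)) := hg.1.integrable_mul hvx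
  have i2 : Integrable (fun p : ℝ × ℝ => k p.1 p.2 * deriv (fun x => v x p.2) p.1)
      (volume.restrict (cylinder T)) := hk.1.integrable_mul hvx
  simp_rw [add_mul, mul_assoc]
  rw [intervalIntegral.integral_add (hf hy.continuousOn) ((hf hz.continuousOn).const_mul s),
    intervalIntegral.integral_add (ht hy.continuousOn) ((ht hz.continuousOn).const_mul s),
    intervalIntegral.integral_add (hu.mul_continuousOn hv1.continuousOn)
      ((hh.mul_continuousOn hv1.continuousOn).const_mul s),
    integral_add (integrable_cylinder (hy.continuousOn.fun_mul hvt))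
      ((integrable_cylinder (hz.continuousOn.fun_mul hvt)).const_mul s),
    integral_add i1 (i2.const_mul s)]
  simp only [intervalIntegral.integral_const_mul, integral_const_mul]
  linear_combination e1 + s * e2

lemma intervalIntegral_eq_integral_Icc {T : ℝ} (hT : 0 ≤ T) (f : ℝ → ℝ) :
    ∫ t in (0 : ℝ)..T, f t = ∫ t in Icc 0 T, f t := by
  rw [intervalIntegral.integral_of_le hT, integral_Icc_eq_integral_Ioc]

lemma IsState.congr_ae {T α : ℝ} (hT : 0 ≤ T) {u w : ℝ → ℝ} {y : ℝ → ℝ → ℝ}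
    (hy : IsState T α u y) (h : u =ᵐ[volume.restrict (Icc 0 T)] w) : IsState T α w y := by
  obtain ⟨g, hg, hgw⟩ := hy.weak
  refine ⟨hy.continuousOn, hy.initial, g, hg, fun v hv => ?_⟩
  rw [hgw v hv, intervalIntegral_eq_integral_Icc hT, intervalIntegral_eq_integral_Icc hT]
  refine integral_congr_ae ?_
  filter_upwards [h] with t ht
  rw [ht]

lemma integral_sq_add_const_mul {ρ : Measure ℝ} {f g : ℝ → ℝ} (hf : MemLp f 2 ρ)
    (hg : MemLp g 2 ρ) (s : ℝ) :
    ∫ x, |f x + s * g x| ^ 2 ∂ρ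
      = (∫ x, |f x| ^ 2 ∂ρ) + 2 * s * (∫ x, f x * g x ∂ρ) + s ^ 2 * ∫ x, g x * g x ∂ρ := by
  have h : ∀ x, |f x + s * g x| ^ 2
      = f x * f x + (2 * s * (f x * g x) + s ^ 2 * (g x * g x)) := fun x => by
    rw [sq_abs]; ring
  simp_rw [h, sq_abs, sq (f _)]
  have i1 : Integrable (fun x => f x * f x) ρ := hf.integrable_mul hf
  have i2 : Integrable (fun x => 2 * s * (f x * g x)) ρ := (hf.integrable_mul hg).const_mul _
  have i3 : Integrable (fun x => s ^ 2 * (g x * g x)) ρ := (hg.integrable_mul hg).const_mul _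
  have i4 : Integrable (fun x => 2 * s * (f x * g x) + s ^ 2 * (g x * g x)) ρ := i2.add i3
  rw [integral_add i1 i4, integral_add i2 i3, integral_const_mul, integral_const_mul]
  ring

lemma memLp_Icc {r : ℝ} {f : ℝ → ℝ} (hf : ContinuousOn f (Icc 0 r)) (e : ENNReal) :
    MemLp f e (volume.restrict (Icc 0 r)) := by
  obtain ⟨C, hC⟩ := isCompact_Icc.exists_bound_of_continuousOn hf
  exact MemLp.of_bound (hf.aestronglyMeasurable measurableSet_Icc) C
    ((ae_restrict_mem measurableSet_Icc).mono fun t ht => hC t ht)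

/-! ### The scalar problem: soft thresholding and projection. -/

/-- The minimiser over `[a,b]` of `r ↦ p r + (ν/2) r² + μ |r|`. -/
noncomputable def shrink (ν μ a b p : ℝ) : ℝ :=
  max a (min b (-(1 / ν) * (p - max (-μ) (min μ p))))

section Shrink

variable {ν μ a b p : ℝ}

lemma shrink_mem (hab : a ≤ b) : a ≤ shrink ν μ a b p ∧ shrink ν μ a b p ≤ b :=
  ⟨le_max_left _ _, max_le hab (min_le_left _ _)⟩

/-- The variational inequality for the strongly convex scalar problem. -/
lemma shrink_variational (hν : 0 < ν) (hμ : 0 < μ) (ha : a < 0) (hb : 0 < b) {r : ℝ}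
    (hr : a ≤ r ∧ r ≤ b) :
    (p + ν * shrink ν μ a b p) * (shrink ν μ a b p - r) + μ * (|shrink ν μ a b p| - |r|) ≤ 0 := by
  -- `c` is the unconstrained minimiser and `w` its projection onto `[a,b]`; `-σ` will be a
  -- subgradient of `μ |·|` at `w`.
  set σ := max (-μ) (min μ p) with hσ
  set c := -(1 / ν) * (p - σ) with hc
  have hσ1 : -μ ≤ σ := le_max_left _ _
  have hσ2 : σ ≤ μ := max_le (by linarith) (min_le_left _ _)
  have hνc : ν * c = -(p - σ) := by rw [hc]; field_simp
  have hw : shrink ν μ a b p = max a (min b c) := rfl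
  set w := shrink ν μ a b p with hwdef
  have hproj : (w - c) * (w - r) ≤ 0 := by
    rw [hw]
    rcases le_total b c with h | h
    · rw [min_eq_left h, max_eq_right (by linarith)]
      nlinarith [hr.2]
    · rw [min_eq_right h]
      rcases le_total a c with h' | h'
      · rw [max_eq_right h', sub_self, zero_mul]
      · rw [max_eq_left h']
        nlinarith [hr.1]
  -- This is the equality case of `-σ r ≤ μ |r|`. It survives the projection because `a < 0 < b`, so
  -- `w` never takes the sign opposite to `c`.
  have hsign : σ * w + μ * |w| = 0 := by
    rcases le_total μ p with h | h
    · have : σ = μ := by rw [hσ, min_eq_left h, max_eq_right (by linarith)]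
      have hcs : c ≤ 0 := by
        by_contra hcp
        have := mul_pos hν (not_le.1 hcp)
        linarith
      have hw0 : w ≤ 0 := by rw [hw]; exact max_le ha.le ((min_le_right _ _).trans hcs)
      rw [this, abs_of_nonpos hw0]; ring
    · rcases le_total (-μ) p with h' | h'
      · have : σ = p := by rw [hσ, min_eq_right h, max_eq_right h']
        have hcs : c = 0 := by rw [hc, this]; ring
        have : w = 0 := by rw [hw, hcs, min_eq_right hb.le, max_eq_right ha.le]
        rw [this]; simp
      · have : σ = -μ := by rw [hσ, min_eq_right h, max_eq_left h']
        have hcs : 0 ≤ c := by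
          by_contra hcp
          have := mul_pos hν (neg_pos.2 (not_le.1 hcp))
          linarith
        have hw0 : 0 ≤ w := by rw [hw]; exact (le_min hb.le hcs).trans (le_max_right _ _)
        rw [this, abs_of_nonneg hw0]; ring
  have hr' : -(σ * r) ≤ μ * |r| := by
    calc -(σ * r) ≤ |σ * r| := neg_le_abs _
      _ = |σ| * |r| := abs_mul _ _
      _ ≤ μ * |r| := mul_le_mul_of_nonneg_right (abs_le.2 ⟨hσ1, hσ2⟩) (abs_nonneg _)
  have e : (p + ν * w) * (w - r) + μ * (|w| - |r|)
      = ν * ((w - c) * (w - r)) + (σ * w + μ * |w|) + (-(σ * r) - μ * |r|) := by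
    linear_combination (w - r) * hνc
  rw [e, hsign]
  have := mul_nonneg hν.le (neg_nonneg.2 hproj)
  linarith

lemma shrink_of_lt (hν : 0 < ν) (hμ : 0 < μ) (ha : a < 0) (hb : 0 < b) (hp : p < -μ - ν * b) :
    shrink ν μ a b p = b := by
  have hνb := mul_pos hν hb
  have : b ≤ -(1 / ν) * (p - -μ) := by
    rw [neg_mul, ← mul_neg, one_div, le_inv_mul_iff₀ hν]; linarith
  rw [shrink, min_eq_right (a := μ) (b := p) (by linarith), max_eq_left (a := -μ) (by linarith), min_eq_left this,
    max_eq_right (by linarith)]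

lemma shrink_of_mem_left (hν : 0 < ν) (hμ : 0 < μ) (ha : a < 0) (hp : p ∈ Ioo (-μ - ν * b) (-μ)) :
    shrink ν μ a b p = -(1 / ν) * (p + μ) := by
  have h1 : -(1 / ν) * (p + μ) ≤ b := by
    rw [neg_mul, ← mul_neg, one_div, inv_mul_le_iff₀ hν]; linarith [hp.1]
  have h2 : 0 ≤ -(1 / ν) * (p + μ) := by
    rw [neg_mul, ← mul_neg, one_div, le_inv_mul_iff₀ hν]; linarith [hp.2]
  rw [shrink, min_eq_right (a := μ) (b := p) (by linarith [hp.2]), max_eq_left (a := -μ) (by linarith [hp.2]),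
    sub_neg_eq_add, min_eq_right h1, max_eq_right (by linarith)]

lemma shrink_of_mem_middle (ha : a < 0) (hb : 0 < b) (hp : p ∈ Ioo (-μ) μ) :
    shrink ν μ a b p = 0 := by
  rw [shrink, min_eq_right hp.2.le, max_eq_right hp.1.le, sub_self, mul_zero, min_eq_right hb.le,
    max_eq_right ha.le]

lemma shrink_of_mem_right (hν : 0 < ν) (hμ : 0 < μ) (hb : 0 < b) (hp : p ∈ Ioo μ (μ - ν * a)) :
    shrink ν μ a b p = -(1 / ν) * (p - μ) := by
  have h1 : a ≤ -(1 / ν) * (p - μ) := by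
    rw [neg_mul, ← mul_neg, one_div, le_inv_mul_iff₀ hν]; linarith [hp.2]
  have h2 : -(1 / ν) * (p - μ) ≤ 0 := by
    rw [neg_mul, ← mul_neg, one_div, inv_mul_le_iff₀ hν]; linarith [hp.1]
  rw [shrink, min_eq_left hp.1.le, max_eq_right (a := -μ) (by linarith), min_eq_right (by linarith),
    max_eq_right h1]

lemma shrink_of_gt (hν : 0 < ν) (hμ : 0 < μ) (ha : a < 0) (hp : μ - ν * a < p) :
    shrink ν μ a b p = a := by
  have hνa := mul_pos hν (neg_pos.2 ha)
  have : -(1 / ν) * (p - μ) ≤ a := by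
    rw [neg_mul, ← mul_neg, one_div, inv_mul_le_iff₀ hν]; linarith
  rw [shrink, min_eq_left (a := μ) (b := p) (by linarith), max_eq_right (a := -μ) (by linarith),
    max_eq_left ((min_le_right _ _).trans this)]

end Shrink

/-! ### First-order optimality. -/

lemma nonneg_of_forall_quadratic {A B : ℝ} (h : ∀ s : ℝ, 0 < s → s ≤ 1 → 0 ≤ s * A + s ^ 2 * B) :
    0 ≤ A := by
  have hlim : Filter.Tendsto (fun s : ℝ => A + s * B) (nhdsWithin 0 (Ioi 0)) (nhds A) := by
    have : Filter.Tendsto (fun s : ℝ => A + s * B) (nhds 0) (nhds (A + 0 * B)) :=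
      (by fun_prop : Continuous fun s : ℝ => A + s * B).tendsto 0
    rw [zero_mul, add_zero] at this
    exact this.mono_left nhdsWithin_le_nhds
  refine ge_of_tendsto hlim ?_
  filter_upwards [Ioc_mem_nhdsGT (zero_lt_one (α := ℝ))] with s hs
  have := h s hs.1 hs.2
  rw [show s * A + s ^ 2 * B = s * (A + s * B) by ring] at this
  exact nonneg_of_mul_nonneg_right this hs.1

/-- First-order optimality: a directional variational inequality between the optimal control and
an admissible control `w`. -/
theorem IsOptimal.variational {T α ν μ a b : ℝ} (hT : 0 < T) (hα : 0 ≤ α) (hμ : 0 < μ)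
    {yΩ : ℝ → ℝ} (hyΩ : ContinuousOn yΩ (Icc (0 : ℝ) 1)) {u : ℝ → ℝ} {y φ : ℝ → ℝ → ℝ}
    (hopt : IsOptimal T α ν μ a b yΩ u y)
    (hφ : IsAdjointState T α (fun x => y x T - yΩ x) φ) {w : ℝ → ℝ} (hw : IsAdmissible T a b w) :
    0 ≤ ∫ t in Icc 0 T, ((φ 1 t + ν * u t) * (w t - u t) + μ * (|w t| - |u t|)) := by
  set ρ : Measure ℝ := volume.restrict (Icc 0 T) with hρ
  have hu2 : MemLp u 2 ρ := hopt.admissible.1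
  have hw2 : MemLp w 2 ρ := hw.1
  set h : ℝ → ℝ := fun t => w t - u t with hh
  have hh2 : MemLp h 2 ρ := hw2.sub hu2
  have hhb : ∀ᵐ t ∂ρ, |h t| ≤ b - a := by
    filter_upwards [hw.2, hopt.admissible.2] with t h1 h2
    rw [abs_le]; constructor <;> simp only [hh] <;> linarith [h1.1, h1.2, h2.1, h2.2]
  have hab : 0 ≤ b - a := by
    have : ρ ≠ 0 := by
      rw [hρ, Ne, Measure.restrict_eq_zero, Real.volume_Icc]; simpa using hT
    have := ae_neBot.2 this
    obtain ⟨t, ht⟩ := hhb.exists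
    exact (abs_nonneg _).trans ht
  -- The duality requires a direction that is measurable and bounded everywhere; a truncated
  -- measurable representative of `h` is one, and changing `h` on a null set does not affect its
  -- states.
  set h' : ℝ → ℝ := fun t => max (-(b - a)) (min (b - a) (hh2.1.mk h t)) with hh'
  have hh'm : Measurable h' :=
    measurable_const.max (measurable_const.min hh2.1.stronglyMeasurable_mk.measurable)
  have hh'b : ∀ t, |h' t| ≤ b - a := fun t =>
    abs_le.2 ⟨le_max_left _ _, max_le (by linarith) (min_le_left _ _)⟩
  have hae : h' =ᵐ[ρ] h := by
    filter_upwards [hh2.1.ae_eq_mk, hhb] with t h1 h2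
    simp only [hh', ← h1]
    rw [abs_le] at h2
    rw [min_eq_right h2.2, max_eq_right h2.1]
  have hyT := continuousOn_final hT.le hopt.state.continuousOn
  have hd : ContinuousOn (fun x => y x T - yΩ x) (Icc 0 1) := hyT.sub hyΩ
  obtain ⟨z, hz', hdual⟩ := hφ.exists_state_duality hT hα hd hh'm hh'b
  have hz := hz'.congr_ae hT.le hae
  have hφ1 : MemLp (fun t => φ 1 t) 2 ρ := memLp_Icc (continuousOn_trace hφ.continuousOn) 2
  have hii : ∀ {f : ℝ → ℝ}, MemLp f 2 ρ → IntervalIntegrable f volume 0 T := fun hf =>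
    (intervalIntegrable_iff_integrableOn_Icc_of_le hT.le).2 (hf.integrable one_le_two)
  have hzT := continuousOn_final hT.le hz.continuousOn
  have hd2 := memLp_Icc hd 2
  have hz2 := memLp_Icc hzT 2
  have iu : Integrable (fun t => |u t|) ρ := (hu2.integrable one_le_two).abs
  have iw : Integrable (fun t => |w t|) ρ := (hw2.integrable one_le_two).abs
  have i1 : Integrable (fun t => φ 1 t * h t) ρ := hφ1.integrable_mul hh2
  have i2 : Integrable (fun t => u t * h t) ρ := hu2.integrable_mul hh2
  have i3 : Integrable (fun t => |w t| - |u t|) ρ := iw.sub iu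
  have hdual' : ∫ x in Icc (0 : ℝ) 1, (y x T - yΩ x) * z x T = ∫ t, φ 1 t * h t ∂ρ := by
    rw [← intervalIntegral_eq_integral_Icc zero_le_one, hdual,
      intervalIntegral_eq_integral_Icc hT.le]
    refine integral_congr_ae ?_
    filter_upwards [hae] with t ht
    rw [ht]
  have hA : ∫ t, ((φ 1 t + ν * u t) * (w t - u t) + μ * (|w t| - |u t|)) ∂ρ
      = (∫ t, φ 1 t * h t ∂ρ) + ν * (∫ t, u t * h t ∂ρ) + μ * ∫ t, (|w t| - |u t|) ∂ρ := by
    have i4 : Integrable (fun t => φ 1 t * h t + ν * (u t * h t)) ρ := i1.add (i2.const_mul ν)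
    rw [← integral_const_mul, ← integral_const_mul, ← integral_add i1 (i2.const_mul ν),
      ← integral_add i4 (i3.const_mul μ)]
    congr 1; ext t; simp only [hh]; ring
  rw [hA]
  refine nonneg_of_forall_quadratic (B := 1 / 2 * (∫ x in Icc (0 : ℝ) 1, z x T * z x T)
    + ν / 2 * ∫ t, h t * h t ∂ρ) fun s hs0 hs1 => ?_
  have hadm : IsAdmissible T a b fun t => u t + s * h t := by
    refine ⟨hu2.add (hh2.const_mul s), ?_⟩
    filter_upwards [hw.2, hopt.admissible.2] with t h1 h2
    simp only [hh]
    constructor <;> nlinarith [h1.1, h1.2, h2.1, h2.2]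
  have hmin := hopt.minimal _ _ hadm
    (hopt.state.add_const_mul hT.le hz (hii hu2) (hii hh2) s)
  simp only [cost, intervalIntegral_eq_integral_Icc hT.le,
    intervalIntegral_eq_integral_Icc zero_le_one] at hmin
  have e1 : ∫ x in Icc (0 : ℝ) 1, |y x T + s * z x T - yΩ x| ^ 2
      = ∫ x in Icc (0 : ℝ) 1, |(y x T - yΩ x) + s * z x T| ^ 2 := by
    congr 1; ext x; congr 2; ring
  rw [e1, integral_sq_add_const_mul hd2 hz2, integral_sq_add_const_mul hu2 hh2, hdual'] at hmin
  -- Convexity of the absolute value replaces differentiation of the nonsmooth term; this is where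
  -- `s ≤ 1` is needed.
  have e2 : ∫ t, |u t + s * h t| ∂ρ ≤ (∫ t, |u t| ∂ρ) + s * ∫ t, (|w t| - |u t|) ∂ρ := by
    rw [← integral_const_mul, ← integral_add iu (i3.const_mul s)]
    refine integral_mono ((hu2.add (hh2.const_mul s)).integrable one_le_two).abs
      (iu.add (i3.const_mul s)) fun t => ?_
    calc |u t + s * h t| = |(1 - s) * u t + s * w t| := by congr 1; simp only [hh]; ring
      _ ≤ |(1 - s) * u t| + |s * w t| := abs_add_le _ _
      _ = (1 - s) * |u t| + s * |w t| := by
          rw [abs_mul, abs_mul, abs_of_nonneg (sub_nonneg.2 hs1), abs_of_pos hs0]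
      _ = |u t| + s * (|w t| - |u t|) := by ring
  have e3 := mul_le_mul_of_nonneg_left e2 hμ.le
  linarith

end SparseHeatControl

/-! ### Identification of the optimal control with `shrink`. -/

theorem theorem3p9 (T α ν μ a b : ℝ) (hT : 0 < T) (hα : 0 ≤ α) (hν : 0 < ν) (hμ : 0 < μ)
    (ha : a < 0) (hb : 0 < b)
    (yΩ : ℝ → ℝ) (hyΩ : ContinuousOn yΩ (Set.Icc (0 : ℝ) 1))
    (u : ℝ → ℝ) (y φ : ℝ → ℝ → ℝ)
    (hopt : SparseHeatControl.IsOptimal T α ν μ a b yΩ u y)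
    (hφ : SparseHeatControl.IsAdjointState T α (fun x => y x T - yΩ x) φ) :
    ∀ᵐ t ∂(MeasureTheory.volume.restrict (Set.Icc (0 : ℝ) T)),
      (φ 1 t ∈ Set.Iio (-μ - ν * b) → u t = b) ∧
      (φ 1 t ∈ Set.Ioo (-μ - ν * b) (-μ) → u t = -(1 / ν) * (φ 1 t + μ)) ∧
      (φ 1 t ∈ Set.Ioo (-μ) μ → u t = 0) ∧
      (φ 1 t ∈ Set.Ioo μ (μ - ν * a) → u t = -(1 / ν) * (φ 1 t - μ)) ∧
      (φ 1 t ∈ Set.Ioi (μ - ν * a) → u t = a) := by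
  open SparseHeatControl in
  set w : ℝ → ℝ := fun t => shrink ν μ a b (φ 1 t) with hw
  have hφ1 := continuousOn_trace hφ.continuousOn
  have hwc : ContinuousOn w (Icc 0 T) :=
    (by unfold shrink; fun_prop : Continuous (shrink ν μ a b)).comp_continuousOn hφ1
  have hwadm : IsAdmissible T a b w :=
    ⟨memLp_Icc hwc 2, Filter.Eventually.of_forall fun t => shrink_mem (ha.trans hb).le⟩
  have hvar := hopt.variational hT hα hμ hyΩ hφ hwadm
  have hu2 := hopt.admissible.1
  have hh2 := hwadm.1.sub hu2
  have hsq : Integrable (fun t => (w t - u t) * (w t - u t)) (volume.restrict (Icc 0 T)) :=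
    hh2.integrable_mul hh2
  have hint : Integrable (fun t => (φ 1 t + ν * u t) * (w t - u t) + μ * (|w t| - |u t|))
      (volume.restrict (Icc 0 T)) :=
    (((memLp_Icc hφ1 2).add (hu2.const_mul ν)).integrable_mul hh2).add
      ((((hwadm.1.integrable one_le_two).abs).sub
        ((hu2.integrable one_le_two).abs)).const_mul μ)
  -- Since `(p + ν u)(w - u) = (p + ν w)(w - u) - ν (w - u)²`, the scalar variational inequality
  -- with `r = u t` leaves the term `-ν (w - u)²`.
  have hle := integral_mono_ae hint (hsq.const_mul (-ν)) (by
    filter_upwards [hopt.admissible.2] with t ht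
    have := shrink_variational (p := φ 1 t) hν hμ ha hb ht
    simp only [hw]
    linarith)
  rw [integral_const_mul] at hle
  have hzero : ∫ t in Icc 0 T, (w t - u t) * (w t - u t) = 0 := by
    have h0 : 0 ≤ ∫ t in Icc 0 T, (w t - u t) * (w t - u t) :=
      integral_nonneg fun t => mul_self_nonneg _
    nlinarith
  have hae := (integral_eq_zero_iff_of_nonneg (fun t => mul_self_nonneg _) hsq).1 hzero
  filter_upwards [hae] with t ht
  have hut : u t = shrink ν μ a b (φ 1 t) := (sub_eq_zero.1 (mul_self_eq_zero.1 ht)).symm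
  rw [hut]
  exact ⟨shrink_of_lt hν hμ ha hb, shrink_of_mem_left hν hμ ha, shrink_of_mem_middle ha hb,
    shrink_of_mem_right hν hμ hb, shrink_of_gt hν hμ ha⟩
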